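/- Let $F$ be a field. Products of permutations are read from left to right, paths in a quiver are composed from right to left (so that in a path algebra $\beta\alpha$ means "first $\alpha$, then $\beta$"), and $\mathsf{Rad}$ denotes the Jacobson radical. For a composition $q=(q_1,\dots,q_k)$ of $5$ let $\mathfrak{S}_q=\mathfrak{S}_{q_1}\times\cdots\times\mathfrak{S}_{q_k}\subseteq\mathfrak{S}_5$ be the Young subgroup and let $\Xi^q\in F\mathfrak{S}_5$ be the sum of the minimal length representatives of the right cosets of $\mathfrak{S}_q$ in $\mathfrak{S}_5$. The descent algebra $\mathscr{D}_5(F)$ is the subalgebra of $F\mathfrak{S}_5$ given by the $F$-linear span of the elements $\Xi^q$. Let $Q$ be the quiver with vertices $1,\dots,6$ and arrows $\alpha:1\to2$, $\beta:2\to3$, $\gamma:3\to4$, $\delta:5\to4$, $\eta:6\to5$ and a loop $\varepsilon:4\to4$. Let $I$ be the two-sided ideal of the path algebra $FQ$ generated by $\varepsilon^2$, $\varepsilon\gamma$ and $\varepsilon\delta$. Let $R$ be the quiver of type $\mathbb{E}_7$ with vertices $1,\dots,7$ and arrows $\alpha:1\to2$, $\beta:2\to3$, $\gamma:3\to4$,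 $\delta:5\to4$, $\eta:6\to5$, $\rho:7\to4$. Let $B=FR$ be its path algebra, with $r_i$ the idempotent at the vertex $i$, and let $A$ be the subalgebra of $B$ generated by the $r_i$ with $i\neq4,7$, by $r_4+r_7$, and by all paths of length at least $1$. Then $\dim_F(B/A)=1$ and $\mathsf{Rad}(A)=\mathsf{Rad}(B)$. Moreover, if $F$ has characteristic $5$, then $\mathscr{D}_5(F)\cong FQ/I$ and $\mathscr{D}_5(F)\cong A$ as $F$-algebras. -/

import Mathlib

noncomputable section

namespace Descent

/-- The symmetric group of degree `n`, in which the composition of permutations is read from left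
to right. -/
abbrev SymGroup (n : ℕ) := (Equiv.Perm (Fin n))ᵐᵒᵖ

/-- The number of inversions of a permutation, i.e., its Coxeter length. -/
def length {n : ℕ} (σ : SymGroup n) : ℕ :=
  (Finset.univ.filter fun x : Fin n × Fin n => x.1 < x.2 ∧ σ.unop x.2 < σ.unop x.1).card

/-- The Young subgroup of a composition: the permutations that preserve every block. -/
def youngSubgroup {n : ℕ} (q : Composition n) : Subgroup (SymGroup n) where
  carrier := {h | ∀ i, q.index (h.unop i) = q.index i}
  mul_mem' := by
    intro a b ha hb i
    simp only [Set.mem_ofPred_eq] at ha hb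
    simp [ha, hb]
  one_mem' := by intro i; simp
  inv_mem' := by
    intro a ha i
    have := ha (a.unop⁻¹ i)
    simp at this
    simp [this]

/-- `σ` has minimal length in its right coset of the Young subgroup. -/
def IsMinRep {n : ℕ} (q : Composition n) (σ : SymGroup n) : Prop :=
  ∀ h ∈ youngSubgroup q, length σ ≤ length (h * σ)

open Classical in
/-- The sum of the minimal length right coset representatives of the Young subgroup. -/
def Xi (R : Type*) [CommRing R] {n : ℕ} (q : Composition n) : MonoidAlgebra R (SymGroup n) :=
  ∑ σ : Equiv.Perm (Fin n) with IsMinRep q (MulOpposite.op σ),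
    MonoidAlgebra.of R (SymGroup n) (MulOpposite.op σ)

theorem index_mono {n : ℕ} (q : Composition n) : Monotone q.index := by
  intro i j hij
  by_contra! h
  have h1 := q.lt_sizeUpTo_index_succ j
  have h2 := q.sizeUpTo_index_le i
  have h3 := q.monotone_sizeUpTo (show (q.index j : ℕ).succ ≤ q.index i from h)
  have h4 : (i : ℕ) ≤ j := hij
  simp at h1 h3
  omega

/-- `σ` is increasing on every block. -/
def IncrOn {n : ℕ} (q : Composition n) (σ : SymGroup n) : Prop :=
  ∀ i j, i < j → q.index i = q.index j → σ.unop i < σ.unop j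

theorem IncrOn.isMinRep {n : ℕ} {q : Composition n} {σ : SymGroup n} (hσ : IncrOn q σ) :
    IsMinRep q σ := by
  intro h hh
  refine Finset.card_le_card_of_injOn (fun x => (h.unop⁻¹ x.1, h.unop⁻¹ x.2)) ?_ ?_
  · rintro ⟨i, j⟩ hx
    simp only [Finset.coe_filter, Finset.mem_univ, true_and, Set.mem_ofPred_eq] at hx ⊢
    obtain ⟨hij, hlt⟩ := hx
    have h1 : q.index i < q.index j := by
      refine lt_of_le_of_ne (index_mono q hij.le) fun he => ?_
      exact absurd (hσ i j hij he) hlt.asymm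
    have h2 := fun i => (inv_mem hh : _ ∈ youngSubgroup q) i
    refine ⟨?_, by simpa using hlt⟩
    by_contra! hc
    have := index_mono q hc
    simp only [MulOpposite.unop_inv] at h2
    rw [h2, h2] at this
    exact absurd h1 this.not_gt
  · rintro ⟨i, j⟩ - ⟨i', j'⟩ - hx
    simpa using hx

theorem exists_incrOn {n : ℕ} (q : Composition n) (σ : SymGroup n) :
    ∃ h ∈ youngSubgroup q, IncrOn q (h * σ) := by
  let key : Fin n → Fin q.length ×ₗ Fin n := fun i => toLex (q.index i, σ.unop i)
  have hk := Tuple.monotone_sort key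
  set s := Tuple.sort key
  have h1 : Monotone (q.index ∘ s) := by
    intro i j hij
    have := hk hij
    simp only [key, Function.comp, Prod.Lex.toLex_le_toLex] at this
    rcases this with h | h
    · exact h.le
    · exact h.1.le
  have h2 : q.index ∘ s = q.index ∘ (1 : Equiv.Perm (Fin n)) :=
    Tuple.unique_monotone h1 (by simpa using index_mono q)
  refine ⟨MulOpposite.op s, fun i => congrFun h2 i, ?_⟩
  intro i j hij he
  have := hk hij.le
  have e1 := congrFun h2 i
  have e2 := congrFun h2 j
  simp only [Function.comp, Equiv.Perm.one_apply] at e1 e2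
  simp only [key, Function.comp, Prod.Lex.toLex_le_toLex] at this
  rcases this with h | h
  · rw [e1, e2, he] at h
    exact absurd h (lt_irrefl _)
  · refine lt_of_le_of_ne (by simpa using h.2) ?_
    simpa using hij.ne

theorem isMinRep_iff {n : ℕ} (q : Composition n) (σ : SymGroup n) : IsMinRep q σ ↔ IncrOn q σ := by
  refine ⟨fun hσ => ?_, IncrOn.isMinRep⟩
  obtain ⟨h, hh, hi⟩ := exists_incrOn q σ
  have hle := hσ h hh
  by_contra hc
  simp only [IncrOn, not_forall] at hc
  obtain ⟨a, b, hab, he, hlt⟩ := hc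
  have hlt' : σ.unop b < σ.unop a :=
    lt_of_le_of_ne (not_lt.mp hlt) (by simpa using hab.ne')
  refine absurd hle (not_le.mpr ?_)
  unfold length
  rw [← Finset.card_image_of_injective (f := fun x : Fin n × Fin n => (h.unop x.1, h.unop x.2))
    (Finset.univ.filter _)
    (by rintro ⟨i, j⟩ ⟨i', j'⟩ hx; simpa using hx)]
  refine Finset.card_lt_card (Finset.ssubset_iff_of_subset ?_ |>.mpr ⟨(a, b), ?_, ?_⟩)
  · intro x hx
    simp only [Finset.mem_image, Finset.mem_filter, Finset.mem_univ, true_and] at hx ⊢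
    obtain ⟨⟨i, j⟩, ⟨hij, hl⟩, rfl⟩ := hx
    refine ⟨?_, by simpa using hl⟩
    have h1 : q.index i < q.index j := by
      refine lt_of_le_of_ne (index_mono q hij.le) fun he => ?_
      exact absurd (hi i j hij he) hl.asymm
    by_contra! hc
    have := index_mono q hc
    simp only [hh i, hh j] at this
    exact absurd h1 this.not_gt
  · simp [hab, hlt']
  · simp only [Finset.mem_image, Finset.mem_filter, Finset.mem_univ, true_and, not_exists, not_and]
    rintro ⟨i, j⟩ ⟨hij, hl⟩ hx
    simp only [Prod.mk.injEq] at hx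
    have e : q.index i = q.index j := by rw [← hh i, ← hh j, hx.1, hx.2, he]
    exact absurd (hi i j hij e) hl.asymm

/-- The descents of a permutation. -/
def des {n : ℕ} (σ : SymGroup n) : Finset (Fin n) :=
  Finset.univ.filter fun i => ∃ j : Fin n, (j : ℕ) = i + 1 ∧ σ.unop j < σ.unop i

/-- The end points of the blocks, except the last one. -/
def ends {n : ℕ} (q : Composition n) : Finset (Fin n) :=
  Finset.univ.filter fun i => ∃ j : Fin n, (j : ℕ) = i + 1 ∧ q.index i ≠ q.index j

theorem incrOn_iff_adj {n : ℕ} (q : Composition n) (σ : SymGroup n) :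
    IncrOn q σ ↔ ∀ i j : Fin n, (j : ℕ) = i + 1 → q.index i = q.index j →
      σ.unop i < σ.unop j := by
  refine ⟨fun h i j hij he => h i j (by rw [Fin.lt_def]; omega) he, fun h => ?_⟩
  have key : ∀ (d : ℕ) (i j : Fin n), (j : ℕ) = i + d + 1 → q.index i = q.index j →
      σ.unop i < σ.unop j := by
    intro d
    induction d with
    | zero => exact fun i j hij he => h i j hij he
    | succ d ih =>
      intro i j hij he
      let k : Fin n := ⟨i + d + 1, by omega⟩
      have h1 : q.index i ≤ q.index k := index_mono q (by rw [Fin.le_def]; simp [k]; omega)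
      have h2 : q.index k ≤ q.index j := index_mono q (by rw [Fin.le_def]; simp [k]; omega)
      have h3 : q.index i = q.index k := le_antisymm h1 (he ▸ h2)
      exact (ih i k rfl h3).trans (h k j (by simp [k]; omega) (h3 ▸ he))
  intro i j hij he
  rw [Fin.lt_def] at hij
  exact key (j - i - 1) i j (by omega) he

theorem incrOn_iff_des {n : ℕ} (q : Composition n) (σ : SymGroup n) :
    IncrOn q σ ↔ des σ ⊆ ends q := by
  rw [incrOn_iff_adj]
  simp only [des, ends, Finset.subset_iff, Finset.mem_filter, Finset.mem_univ, true_and]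
  constructor
  · rintro h i ⟨j, hj, hl⟩
    exact ⟨j, hj, fun he => absurd (h i j hj he) hl.asymm⟩
  · intro h i j hj he
    by_contra! hl
    have hne : σ.unop j ≠ σ.unop i := by
      simp only [ne_eq, EmbeddingLike.apply_eq_iff_eq, Fin.ext_iff]; omega
    obtain ⟨j', hj', hne'⟩ := h ⟨j, hj, lt_of_le_of_ne hl hne⟩
    have : j' = j := by rw [Fin.ext_iff]; omega
    exact hne' (this ▸ he)

theorem exists_ends {n : ℕ} (S : Finset (Fin n)) (hS : ∀ i ∈ S, (i : ℕ) + 1 < n) :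
    ∃ q : Composition n, ends q = S := by
  classical
  let c : CompositionAsSet n :=
    { boundaries := insert 0 (insert (Fin.last n) (S.image Fin.succ))
      zero_mem := by simp
      getLast_mem := by simp }
  let q := c.toComposition
  have hb : q.boundaries = c.boundaries := c.toComposition_boundaries
  refine ⟨q, ?_⟩
  ext i
  simp only [ends, Finset.mem_filter, Finset.mem_univ, true_and]
  have mem_iff : ∀ j : Fin n, (j : ℕ) = i + 1 → (i ∈ S ↔ ∃ k ≤ q.length, q.sizeUpTo k = j) := by
    intro j hj
    have h1 : i ∈ S ↔ i.succ ∈ q.boundaries := by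
      rw [hb]
      have h2 : i.succ ≠ Fin.last n := by
        have := j.2
        simp only [ne_eq, Fin.ext_iff, Fin.val_succ, Fin.val_last]; omega
      simp [c, h2, Fin.succ_ne_zero]
    rw [h1]
    simp only [Composition.boundaries, Composition.boundary, Finset.mem_map, Finset.mem_univ,
      true_and, Fin.ext_iff]
    constructor
    · rintro ⟨k, hk⟩
      exact ⟨k, by omega, by simpa [hj] using hk⟩
    · rintro ⟨k, hk, hk'⟩
      exact ⟨⟨k, by omega⟩, by simpa [hj] using hk'⟩
  constructor
  · rintro ⟨j, hj, hne⟩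
    rw [mem_iff j hj]
    have hlt : q.index i < q.index j :=
      lt_of_le_of_ne (index_mono q (by rw [Fin.le_def]; omega)) hne
    refine ⟨q.index j, (q.index j).2.le, ?_⟩
    have h1 := q.lt_sizeUpTo_index_succ i
    have h2 := q.sizeUpTo_index_le j
    have h3 := q.monotone_sizeUpTo (show (q.index i : ℕ).succ ≤ q.index j from hlt)
    simp only [Nat.succ_eq_add_one, Fin.val_succ] at h1 h3
    omega
  · intro hi
    refine ⟨⟨i + 1, hS i hi⟩, rfl, fun he => ?_⟩
    obtain ⟨k, hk, hk'⟩ := (mem_iff ⟨i + 1, hS i hi⟩ rfl).mp hi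
    have h1 := q.sizeUpTo_index_le i
    have h2 : (i : ℕ) + 1 < q.sizeUpTo (q.index i + 1) :=
      he ▸ q.lt_sizeUpTo_index_succ ⟨i + 1, hS i hi⟩
    replace hk' : q.sizeUpTo k = i + 1 := hk'
    have h3 : (q.index i : ℕ) < k := by
      by_contra! hc
      have := q.monotone_sizeUpTo hc
      omega
    have h4 : k < q.index i + 1 := by
      by_contra! hc
      have := q.monotone_sizeUpTo hc
      omega
    omega

variable (R : Type*) [CommRing R]

/-- The sum of the permutations with a given set of descents. -/
def desSum {n : ℕ} (S : Finset (Fin n)) : MonoidAlgebra R (SymGroup n) :=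
  ∑ σ : Equiv.Perm (Fin n) with des (MulOpposite.op σ) = S,
    MonoidAlgebra.of R (SymGroup n) (MulOpposite.op σ)

theorem Xi_eq {n : ℕ} (q : Composition n) :
    Xi R q = ∑ S ∈ (ends q).powerset, desSum R S := by
  classical
  unfold Xi desSum
  rw [← Finset.sum_biUnion]
  · refine Finset.sum_congr ?_ fun _ _ => rfl
    ext σ
    simp [isMinRep_iff, incrOn_iff_des]
  · intro S _ T _ hST
    rw [Function.onFun, Finset.disjoint_left]
    intro σ hσ hσ'
    simp only [Finset.mem_filter, Finset.mem_univ, true_and] at hσ hσ'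
    exact hST (hσ.symm.trans hσ')

theorem desSum_mem {n : ℕ} (S : Finset (Fin n)) :
    desSum R S ∈ Submodule.span R (Set.range (Xi R (n := n))) := by
  classical
  induction S using Finset.strongInduction with
  | H S ih =>
  by_cases hS : ∀ i ∈ S, (i : ℕ) + 1 < n
  · obtain ⟨q, rfl⟩ := exists_ends S hS
    have h := Xi_eq R q
    rw [← Finset.sum_erase_add _ _ (Finset.mem_powerset_self _)] at h
    rw [← sub_eq_iff_eq_add'.mpr h]
    refine Submodule.sub_mem _ (Submodule.subset_span ⟨q, rfl⟩) (Submodule.sum_mem _ ?_)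
    intro T hT
    rw [Finset.mem_erase, Finset.mem_powerset] at hT
    exact ih T (lt_of_le_of_ne hT.2 hT.1)
  · have : desSum R S = 0 := by
      refine Finset.sum_eq_zero fun σ hσ => ?_
      simp only [Finset.mem_filter, Finset.mem_univ, true_and] at hσ
      refine absurd (fun i hi => ?_) hS
      rw [← hσ] at hi
      simp only [des, Finset.mem_filter, Finset.mem_univ, true_and] at hi
      obtain ⟨j, hj, -⟩ := hi
      omega
    rw [this]
    exact zero_mem _

theorem mem_span_of_des {n : ℕ} (f : SymGroup n → R) (hf : ∀ v w, des v = des w → f v = f w) :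
    ∑ σ : Equiv.Perm (Fin n),
      f (MulOpposite.op σ) • MonoidAlgebra.of R (SymGroup n) (MulOpposite.op σ) ∈
        Submodule.span R (Set.range (Xi R (n := n))) := by
  classical
  rw [← Finset.sum_fiberwise _ (fun σ : Equiv.Perm (Fin n) => des (MulOpposite.op σ))]
  refine Submodule.sum_mem _ fun S _ => ?_
  by_cases hS : ∃ v : SymGroup n, des v = S
  · obtain ⟨v, rfl⟩ := hS
    convert Submodule.smul_mem _ (f v) (desSum_mem R (des v)) using 1
    rw [desSum, Finset.smul_sum]
    refine Finset.sum_congr rfl fun σ hσ => ?_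
    rw [hf _ v (by simpa using hσ)]
  · convert Submodule.zero_mem _
    refine Finset.sum_eq_zero fun σ hσ => ?_
    exact absurd ⟨_, by simpa using hσ⟩ hS

open Classical in
/-- The factorisations of `w` into minimal coset representatives of two Young subgroups. -/
def factor {n : ℕ} (q r : Composition n) (w : SymGroup n) : Finset (Equiv.Perm (Fin n)) :=
  Finset.univ.filter fun u => IncrOn q (MulOpposite.op u) ∧ IncrOn r ((MulOpposite.op u)⁻¹ * w)

open Classical in
/-- Words in which the blocks of `r` appear in some order and which are increasing on the blocks
of `q`, strictly at the positions in `S`. -/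
def words {n : ℕ} (q r : Composition n) (S : Finset (Fin n)) : Finset (Fin n → Fin r.length) :=
  Finset.univ.filter fun G => (∃ π : Equiv.Perm (Fin n), G = r.index ∘ π) ∧
    ∀ i j : Fin n, (j : ℕ) = i + 1 → q.index i = q.index j → G i ≤ G j ∧ (i ∈ S → G i ≠ G j)

theorem card_factor {n : ℕ} (q r : Composition n) (w : SymGroup n) :
    (factor q r w).card = (words q r (des w)).card := by
  classical
  have sort_eq : ∀ u ∈ factor q r w,
      w.unop * u⁻¹ = Tuple.sort (r.index ∘ u ∘ w.unop.symm) := by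
    intro u hu
    simp only [factor, Finset.mem_filter, Finset.mem_univ, true_and] at hu
    rw [Tuple.eq_sort_iff]
    have e : (r.index ∘ u ∘ w.unop.symm) ∘ (w.unop * u⁻¹ : Equiv.Perm (Fin n)) = r.index := by
      ext i; simp
    refine ⟨by rw [e]; exact index_mono r, fun i j hij he => ?_⟩
    exact hu.2 i j hij (by simpa using he)
  refine Finset.card_bij (fun u _ => r.index ∘ u) ?_ ?_ ?_
  · intro u hu
    simp only [factor, Finset.mem_filter, Finset.mem_univ, true_and] at hu
    simp only [words, Finset.mem_filter, Finset.mem_univ, true_and]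
    refine ⟨⟨u, rfl⟩, fun i j hj he => ?_⟩
    have hij : i < j := by rw [Fin.lt_def]; omega
    have h1 : u i < u j := hu.1 i j hij he
    refine ⟨index_mono r h1.le, fun hi h2 => ?_⟩
    have h3 := hu.2 _ _ h1 h2
    simp only [des, Finset.mem_filter, Finset.mem_univ, true_and] at hi
    obtain ⟨j', hj', hl⟩ := hi
    obtain rfl : j' = j := by rw [Fin.ext_iff]; omega
    simp at h3
    exact absurd h3 hl.asymm
  · intro u hu u' hu' h
    have h1 := sort_eq u hu
    have h2 := sort_eq u' hu'
    rw [← Function.comp_assoc, h, Function.comp_assoc, ← h2] at h1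
    simpa using h1
  · intro G hG
    simp only [words, Finset.mem_filter, Finset.mem_univ, true_and] at hG
    obtain ⟨⟨π, rfl⟩, hG⟩ := hG
    obtain ⟨v, hv⟩ : ∃ v, v = Tuple.sort ((r.index ∘ π) ∘ w.unop.symm) := ⟨_, rfl⟩
    rw [Tuple.eq_sort_iff] at hv
    obtain ⟨hv1, hv2⟩ := hv
    have h1 : r.index ∘ (π * w.unop⁻¹ * v : Equiv.Perm (Fin n)) =
        r.index ∘ (1 : Equiv.Perm (Fin n)) :=
      Tuple.unique_monotone hv1 (by simpa using index_mono r)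
    have h2 : ∀ i, r.index (π (w.unop.symm (v i))) = r.index i := fun i => congrFun h1 i
    have h3 : ∀ i, r.index ((v⁻¹ * w.unop : Equiv.Perm (Fin n)) i) = r.index (π i) := by
      intro i
      have := h2 ((v⁻¹ * w.unop : Equiv.Perm (Fin n)) i)
      simpa using this.symm
    have h4 : ∀ i j, i < j → r.index i = r.index j → v i < v j := by
      intro i j hij he
      refine hv2 i j hij ?_
      simp only [Function.comp]
      rw [h2, h2, he]
    refine ⟨v⁻¹ * w.unop, ?_, funext h3⟩
    simp only [factor, Finset.mem_filter, Finset.mem_univ, true_and]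
    refine ⟨?_, ?_⟩
    · rw [incrOn_iff_adj]
      intro i j hj he
      obtain ⟨hle, hne⟩ := hG i j hj he
      simp only [Function.comp] at hle hne
      simp only [MulOpposite.unop_op]
      set u := v⁻¹ * w.unop with hu
      have hw : ∀ i, v (u i) = w.unop i := by intro i; simp [hu]
      have hij : u i ≠ u j := by
        simp only [ne_eq, EmbeddingLike.apply_eq_iff_eq, Fin.ext_iff]; omega
      rw [← h3, ← h3] at hle hne
      by_contra! hc
      have hlt : u j < u i := lt_of_le_of_ne hc hij.symm
      have he2 := le_antisymm hle (index_mono r hc)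
      refine hne ?_ he2
      simp only [des, Finset.mem_filter, Finset.mem_univ, true_and]
      refine ⟨j, hj, ?_⟩
      rw [← hw, ← hw]
      exact h4 _ _ hlt he2.symm
    · intro i j hij he
      simpa using h4 i j hij he

/-- The product of two of the elements `Xi` is a linear combination of such elements. -/
theorem Xi_mul_Xi_mem {n : ℕ} (q r : Composition n) :
    Xi R q * Xi R r ∈ Submodule.span R (Set.range (Xi R (n := n))) := by
  classical
  convert mem_span_of_des R (fun w : SymGroup n => ((factor q r w).card : R)) ?_ using 1
  · simp only [Finset.card_eq_sum_ones, factor, Finset.sum_filter, Nat.cast_sum, Nat.cast_ite,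
      Finset.sum_smul]
    rw [Finset.sum_comm]
    simp only [Xi, isMinRep_iff]
    rw [Finset.sum_mul, Finset.sum_filter]
    refine Finset.sum_congr rfl fun u _ => ?_
    rw [← Equiv.sum_comp (Equiv.mulRight u)]
    split_ifs with hu
    · rw [Finset.mul_sum, Finset.sum_filter]
      refine Finset.sum_congr rfl fun v _ => ?_
      simp only [hu, true_and, Equiv.coe_mulRight, MulOpposite.op_mul, inv_mul_cancel_left,
        map_mul]
      split_ifs <;> simp
    · simp [hu]
  · intro v w h
    simp only [card_factor, h]

theorem one_mem_span {n : ℕ} :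
    (1 : MonoidAlgebra R (SymGroup n)) ∈ Submodule.span R (Set.range (Xi R (n := n))) := by
  classical
  suffices h : ∃ q : Composition n, Xi R q = 1 from Submodule.subset_span h
  obtain ⟨q, hq⟩ : ∃ q : Composition n, ∀ i j, q.index i = q.index j := by
    rcases Nat.eq_zero_or_pos n with rfl | h
    · exact ⟨default, fun i => i.elim0⟩
    · refine ⟨Composition.single n h, fun i j => ?_⟩
      have h1 := ((Composition.single n h).index i).2
      have h2 := ((Composition.single n h).index j).2
      have h3 := Composition.single_length h
      rw [Fin.ext_iff]
      omega
  refine ⟨q, ?_⟩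
  rw [Xi, Finset.sum_eq_single 1]
  · rfl
  · intro σ hσ hne
    simp only [isMinRep_iff, Finset.mem_filter, Finset.mem_univ, true_and] at hσ
    have h1 : StrictMono σ := fun i j hij => hσ i j hij (hq i j)
    refine absurd (Equiv.ext fun i => ?_) hne
    exact congrFun (Tuple.unique_monotone (f := id) (σ := σ) (τ := 1)
      h1.monotone monotone_id) i
  · intro h
    refine absurd ?_ h
    simp only [isMinRep_iff, Finset.mem_filter, Finset.mem_univ, true_and]
    exact fun i j hij _ => hij

/-- The descent algebra: the linear span of the elements `Xi`. -/
def descentAlgebra (n : ℕ) : Subalgebra R (MonoidAlgebra R (SymGroup n)) :=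
  (Submodule.span R (Set.range (Xi R (n := n)))).toSubalgebra (one_mem_span R) <| by
    intro x y hx hy
    induction hx using Submodule.span_induction with
    | zero => simp
    | add x x' _ _ hx hx' => rw [add_mul]; exact add_mem hx hx'
    | smul c x _ hx => rw [smul_mul_assoc]; exact Submodule.smul_mem _ c hx
    | mem x hx =>
    induction hy using Submodule.span_induction with
    | zero => simp
    | add y y' _ _ hy hy' => rw [mul_add]; exact add_mem hy hy'
    | smul c y _ hy => rw [mul_smul_comm]; exact Submodule.smul_mem _ c hy
    | mem y hy =>
    obtain ⟨q, rfl⟩ := hx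
    obtain ⟨r, rfl⟩ := hy
    exact Xi_mul_Xi_mem R q r

end Descent

/-- A path in a quiver, together with its starting and terminating vertices. -/
abbrev QPath (V : Type*) [Quiver V] := Σ a b : V, Quiver.Path a b

/-- The path algebra: the free `F`-module on the set of all paths (including the paths of length
zero). -/
def PathAlgebra (F V : Type*) [CommRing F] [Quiver V] := QPath V →₀ F

namespace PathAlgebra

variable (F : Type*) {V : Type*} [CommRing F] [Quiver V]

instance : AddCommGroup (PathAlgebra F V) := inferInstanceAs (AddCommGroup (QPath V →₀ F))

instance : Module F (PathAlgebra F V) := inferInstanceAs (Module F (QPath V →₀ F))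

/-- The paths form a basis of the path algebra. -/
def basis : Module.Basis (QPath V) F (PathAlgebra F V) :=
  Module.Basis.ofRepr (LinearEquiv.refl F (QPath V →₀ F))

/-- The path from `a` to `b`, as an element of the path algebra. -/
def ofPath {a b : V} (p : Quiver.Path a b) : PathAlgebra F V := basis F ⟨a, b, p⟩

/-- The path of length zero at `v`. -/
def vertex (v : V) : PathAlgebra F V := ofPath F (Quiver.Path.nil : Quiver.Path v v)

/-- An arrow, as a path of length one. -/
def arrow {a b : V} (e : a ⟶ b) : PathAlgebra F V := ofPath F e.toPath

open Classical in
/-- The product of two paths. Composition of paths is read from right to left, so that `p * q` is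
"first `q`, then `p`" if `p` starts where `q` terminates, and it is `0` otherwise. -/
def mulPath (p q : QPath V) : PathAlgebra F V :=
  if h : q.2.1 = p.1 then ofPath F ((q.2.2.cast rfl h).comp p.2.2) else 0

/-- The bilinear extension of the product of paths. -/
def mulHom : PathAlgebra F V →ₗ[F] PathAlgebra F V →ₗ[F] PathAlgebra F V :=
  (basis F).constr F fun p => (basis F).constr F fun q => mulPath F p q

instance : Mul (PathAlgebra F V) := ⟨fun x y => mulHom F x y⟩

variable {F}

theorem mul_eq (x y : PathAlgebra F V) : x * y = mulHom F x y := rfl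

theorem basis_mul_basis (p q : QPath V) : basis F p * basis F q = mulPath F p q := by
  simp [mul_eq, mulHom, Module.Basis.constr_basis]

theorem ofPath_mul_ofPath {a b c : V} (p : Quiver.Path b c) (q : Quiver.Path a b) :
    ofPath F p * ofPath F q = ofPath F (q.comp p) := by
  simp [ofPath, basis_mul_basis, mulPath]

theorem ofPath_mul_ofPath_of_ne {a b c d : V} (p : Quiver.Path c d) (q : Quiver.Path a b)
    (h : b ≠ c) : ofPath F p * ofPath F q = 0 := by
  simp [ofPath, basis_mul_basis, mulPath, h]

theorem add_mul' (x y z : PathAlgebra F V) : (x + y) * z = x * z + y * z := by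
  simp [mul_eq]

theorem mul_add' (x y z : PathAlgebra F V) : x * (y + z) = x * y + x * z := by
  simp [mul_eq]

theorem smul_mul' (c : F) (x y : PathAlgebra F V) : (c • x) * y = c • (x * y) := by
  simp [mul_eq]

theorem mul_smul' (c : F) (x y : PathAlgebra F V) : x * (c • y) = c • (x * y) := by
  simp [mul_eq]

theorem zero_mul' (x : PathAlgebra F V) : 0 * x = 0 := by
  simp [mul_eq]

theorem mul_zero' (x : PathAlgebra F V) : x * 0 = 0 := by
  simp [mul_eq]

theorem induction {P : PathAlgebra F V → Prop} (x : PathAlgebra F V) (zero : P 0)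
    (path : ∀ (a b : V) (p : Quiver.Path a b), P (ofPath F p))
    (add : ∀ x y, P x → P y → P (x + y)) (smul : ∀ (c : F) x, P x → P (c • x)) : P x := by
  have hx : x ∈ Submodule.span F (Set.range (basis F (V := V))) := (basis F).mem_span x
  induction hx using Submodule.span_induction with
  | mem x h => obtain ⟨⟨a, b, p⟩, rfl⟩ := h; exact path a b p
  | zero => exact zero
  | add x y _ _ hx hy => exact add x y hx hy
  | smul c x _ hx => exact smul c x hx

theorem mul_assoc' (x y z : PathAlgebra F V) : x * y * z = x * (y * z) := by
  induction x using induction with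
  | zero => simp only [zero_mul']
  | add x x' hx hx' => simp only [add_mul', hx, hx']
  | smul c x hx => simp only [smul_mul', hx]
  | path c' d p =>
  induction y using induction with
  | zero => simp only [zero_mul', mul_zero']
  | add y y' hy hy' => simp only [add_mul', mul_add', hy, hy']
  | smul c y hy => simp only [smul_mul', mul_smul', hy]
  | path b' c q =>
  induction z using induction with
  | zero => simp only [mul_zero']
  | add z z' hz hz' => simp only [mul_add', hz, hz']
  | smul c z hz => simp only [mul_smul', hz]
  | path a b r =>
  by_cases h : c = c'
  · subst h
    by_cases h' : b = b'
    · subst h'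
      simp only [ofPath_mul_ofPath, Quiver.Path.comp_assoc]
    · rw [ofPath_mul_ofPath, ofPath_mul_ofPath_of_ne _ _ h', ofPath_mul_ofPath_of_ne _ _ h',
        mul_zero']
  · by_cases h' : b = b'
    · subst h'
      rw [ofPath_mul_ofPath, ofPath_mul_ofPath_of_ne _ _ h, ofPath_mul_ofPath_of_ne _ _ h, zero_mul']
    · rw [ofPath_mul_ofPath_of_ne _ _ h, ofPath_mul_ofPath_of_ne _ _ h', mul_zero', zero_mul']

/-- The identity is the sum of all the paths of length zero. -/
instance [Fintype V] : One (PathAlgebra F V) := ⟨∑ v : V, vertex F v⟩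

theorem one_eq [Fintype V] : (1 : PathAlgebra F V) = ∑ v : V, vertex F v := rfl

theorem one_mul' [Fintype V] (x : PathAlgebra F V) : 1 * x = x := by
  classical
  induction x using induction with
  | zero => exact mul_zero' 1
  | add x y hx hy => rw [mul_add', hx, hy]
  | smul c x hx => rw [mul_smul', hx]
  | path a b p =>
    have h : (1 : PathAlgebra F V) * ofPath F p = ∑ v : V, vertex F v * ofPath F p := by
      simp only [one_eq, mul_eq, map_sum, LinearMap.sum_apply]
    rw [h, Finset.sum_eq_single b]
    · exact ofPath_mul_ofPath _ _
    · exact fun v _ hv => ofPath_mul_ofPath_of_ne _ _ hv.symm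
    · simp

theorem mul_one' [Fintype V] (x : PathAlgebra F V) : x * 1 = x := by
  classical
  induction x using induction with
  | zero => exact zero_mul' 1
  | add x y hx hy => rw [add_mul', hx, hy]
  | smul c x hx => rw [smul_mul', hx]
  | path a b p =>
    have h : ofPath F p * (1 : PathAlgebra F V) = ∑ v : V, ofPath F p * vertex F v := by
      simp only [one_eq, mul_eq, map_sum]
    rw [h, Finset.sum_eq_single a]
    · rw [vertex, ofPath_mul_ofPath, Quiver.Path.nil_comp]
    · exact fun v _ hv => ofPath_mul_ofPath_of_ne _ _ hv
    · simp

instance [Fintype V] : Ring (PathAlgebra F V) :=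
  { (inferInstance : AddCommGroup (PathAlgebra F V)) with
    mul := (· * ·)
    one := 1
    left_distrib := mul_add'
    right_distrib := add_mul'
    zero_mul := zero_mul'
    mul_zero := mul_zero'
    mul_assoc := mul_assoc'
    one_mul := one_mul'
    mul_one := mul_one' }

instance [Fintype V] : Algebra F (PathAlgebra F V) :=
  Algebra.ofModule smul_mul' mul_smul'

end PathAlgebra

namespace LoopQuiver

/-- The vertices of the quiver `1 → 2 → 3 → 4 ← 5 ← 6` with a loop at `4`. -/
inductive Vertex
  | v1 | v2 | v3 | v4 | v5 | v6
  deriving DecidableEq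

open Vertex

instance : Fintype Vertex := ⟨{v1, v2, v3, v4, v5, v6}, fun x => by cases x <;> simp⟩

/-- The arrows of the quiver `1 → 2 → 3 → 4 ← 5 ← 6` with a loop `ε` at `4`. -/
inductive Arrow : Vertex → Vertex → Type
  | α : Arrow v1 v2
  | β : Arrow v2 v3
  | γ : Arrow v3 v4
  | δ : Arrow v5 v4
  | η : Arrow v6 v5
  | ε : Arrow v4 v4

instance : Quiver Vertex := ⟨Arrow⟩

def γ : (v3 : Vertex) ⟶ v4 := Arrow.γ

def δ : (v5 : Vertex) ⟶ v4 := Arrow.δ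

def ε : (v4 : Vertex) ⟶ v4 := Arrow.ε

open PathAlgebra in
/-- The two-sided ideal generated by `ε²`, `εγ` and `εδ`. -/
def relations (F : Type*) [CommRing F] : TwoSidedIdeal (PathAlgebra F Vertex) :=
  TwoSidedIdeal.span
    {arrow F ε * arrow F ε, arrow F ε * arrow F γ, arrow F ε * arrow F δ}

end LoopQuiver

namespace E7Quiver

/-- The vertices of the quiver `1 → 2 → 3 → 4 ← 5 ← 6`, `7 → 4` of type `E₇`. -/
inductive Vertex
  | v1 | v2 | v3 | v4 | v5 | v6 | v7
  deriving DecidableEq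

open Vertex

instance : Fintype Vertex := ⟨{v1, v2, v3, v4, v5, v6, v7}, fun x => by cases x <;> simp⟩

/-- The arrows of the quiver `1 → 2 → 3 → 4 ← 5 ← 6`, `7 → 4` of type `E₇`. -/
inductive Arrow : Vertex → Vertex → Type
  | α : Arrow v1 v2
  | β : Arrow v2 v3
  | γ : Arrow v3 v4
  | δ : Arrow v5 v4
  | η : Arrow v6 v5
  | ρ : Arrow v7 v4

instance : Quiver Vertex := ⟨Arrow⟩

open PathAlgebra in
/-- The subalgebra of the path algebra generated by the idempotents at the vertices other than
`4` and `7`, the sum of the idempotents at `4` and `7`, and all paths of length at least one. -/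
def mergedSubalgebra (F : Type*) [CommRing F] : Subalgebra F (PathAlgebra F Vertex) :=
  Algebra.adjoin F
    ({x | ∃ i : Vertex, i ≠ v4 ∧ i ≠ v7 ∧ x = vertex F i} ∪
      {vertex F v4 + vertex F v7} ∪
      {x | ∃ (a b : Vertex) (p : Quiver.Path a b), 1 ≤ p.length ∧ x = ofPath F p})

end E7Quiver

end

noncomputable section

/-- If a family of characters of an algebra is such that the elements killed by all the characters
are nilpotent, then the Jacobson radical is the intersection of the kernels. -/
theorem mem_jacobson_iff_of_characters {F S ι : Type*} [Field F] [Ring S] [Algebra F S]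
    (χ : ι → S →ₐ[F] F) (hχ : ∀ x, (∀ i, χ i x = 0) → IsNilpotent x) (x : S) :
    x ∈ Ring.jacobson S ↔ ∀ i, χ i x = 0 := by
  rw [← Ideal.jacobson_bot]
  constructor
  · intro hx i
    have hmax : (RingHom.ker (χ i)).IsMaximal :=
      RingHom.ker_isMaximal_of_surjective (χ i) fun c => ⟨algebraMap F S c, by simp⟩
    exact (Ideal.mem_sInf.mp hx) ⟨bot_le, hmax⟩
  · intro hx
    rw [Ideal.mem_jacobson_iff]
    intro y
    have hn : IsNilpotent (y * x) := hχ _ fun i => by simp [hx i]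
    obtain ⟨u, hu⟩ := hn.isUnit_add_one
    refine ⟨(u⁻¹ : Sˣ), ?_⟩
    have h : ((u⁻¹ : Sˣ) : S) * (y * x + 1) = 1 := by rw [← hu]; simp
    rw [mul_add, mul_one, ← mul_assoc] at h
    simp [h]

namespace PathAlgebra

section lift

variable {F V S : Type*} [Field F] [Quiver V] [Ring S] [Algebra F S]

/-- The product of the values of the arrows of a path, multiplied from right to left. -/
def pathValue (e : V → S) (a : ∀ i j : V, (i ⟶ j) → S) {i : V} :
    ∀ {j : V}, Quiver.Path i j → S
  | _, .nil => e i
  | _, .cons p f => a _ _ f * pathValue e a p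

variable {e : V → S} {a : ∀ i j : V, (i ⟶ j) → S}

theorem vertex_mul_pathValue (he : ∀ i, e i * e i = e i)
    (hl : ∀ i j (f : i ⟶ j), e j * a i j f = a i j f) {i j : V} (p : Quiver.Path i j) :
    e j * pathValue e a p = pathValue e a p := by
  cases p with
  | nil => exact he i
  | cons p f => simp only [pathValue, ← mul_assoc, hl]

theorem pathValue_mul_vertex (he : ∀ i, e i * e i = e i) {i j : V} (p : Quiver.Path i j) :
    pathValue e a p * e i = pathValue e a p := by
  induction p with
  | nil => exact he i
  | cons p f ih => simp only [pathValue, mul_assoc, ih]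

theorem pathValue_comp (he : ∀ i, e i * e i = e i)
    (hl : ∀ i j (f : i ⟶ j), e j * a i j f = a i j f) {i j k : V} (p : Quiver.Path i j)
    (q : Quiver.Path j k) :
    pathValue e a (p.comp q) = pathValue e a q * pathValue e a p := by
  induction q with
  | nil => exact (vertex_mul_pathValue he hl p).symm
  | cons q f ih => simp only [Quiver.Path.comp_cons, pathValue, mul_assoc, ih]

variable [Fintype V]

/-- The algebra homomorphism from a path algebra given by a complete family of orthogonal
idempotents and by compatible values of the arrows. -/
def lift (e : V → S) (a : ∀ i j : V, (i ⟶ j) → S) (he : ∀ i, e i * e i = e i)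
    (ho : ∀ i j, i ≠ j → e i * e j = 0) (h1 : ∑ i, e i = 1)
    (hl : ∀ i j (f : i ⟶ j), e j * a i j f = a i j f) : PathAlgebra F V →ₐ[F] S :=
  AlgHom.ofLinearMap ((basis F).constr F fun p => pathValue e a p.2.2)
    (by
      rw [one_eq, map_sum, ← h1]
      refine Finset.sum_congr rfl fun v _ => ?_
      simp only [vertex, ofPath, Module.Basis.constr_basis, pathValue])
    (by
      intro x y
      induction x using induction with
      | zero => simp only [zero_mul, map_zero]
      | add x x' hx hx' => simp only [add_mul, map_add, hx, hx']
      | smul c x hx => simp only [smul_mul_assoc, map_smul, hx]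
      | path c d p =>
      induction y using induction with
      | zero => simp only [mul_zero, map_zero]
      | add y y' hy hy' => simp only [mul_add, map_add, hy, hy']
      | smul c y hy => simp only [mul_smul_comm, map_smul, hy]
      | path b b' q =>
      by_cases h : b' = c
      · subst h
        rw [ofPath_mul_ofPath]
        simp only [ofPath, Module.Basis.constr_basis]
        exact pathValue_comp he hl q p
      · rw [ofPath_mul_ofPath_of_ne _ _ h, map_zero]
        simp only [ofPath, Module.Basis.constr_basis]
        rw [← pathValue_mul_vertex he p, ← vertex_mul_pathValue he hl q, mul_assoc,
          ← mul_assoc (e c), ho _ _ (Ne.symm h), zero_mul, mul_zero])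

variable (he : ∀ i, e i * e i = e i) (ho : ∀ i j, i ≠ j → e i * e j = 0) (h1 : ∑ i, e i = 1)
  (hl : ∀ i j (f : i ⟶ j), e j * a i j f = a i j f)

theorem lift_ofPath {i j : V} (p : Quiver.Path i j) :
    lift (F := F) e a he ho h1 hl (ofPath F p) = pathValue e a p := by
  simp [lift, ofPath, Module.Basis.constr_basis]

theorem lift_vertex (i : V) : lift (F := F) e a he ho h1 hl (vertex F i) = e i :=
  lift_ofPath he ho h1 hl _

theorem lift_arrow {i j : V} (f : i ⟶ j) (hr : a i j f * e i = a i j f) :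
    lift (F := F) e a he ho h1 hl (arrow F f) = a i j f := by
  rw [arrow, lift_ofPath]
  exact hr

end lift

section character

variable (F : Type*) {V : Type*} [Field F] [Quiver V]

/-- The span of the paths of length at least `n`. -/
def longPaths (V : Type*) [Quiver V] (n : ℕ) : Submodule F (PathAlgebra F V) :=
  Submodule.span F {x | ∃ (i j : V) (p : Quiver.Path i j), n ≤ p.length ∧ x = ofPath F p}

theorem ofPath_mem_longPaths {F V : Type*} [Field F] [Quiver V] {n : ℕ} {i j : V}
    (p : Quiver.Path i j) (h : n ≤ p.length) :
    ofPath F p ∈ longPaths F V n :=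
  Submodule.subset_span ⟨i, j, p, h, rfl⟩

theorem ofPath_cons {i j k : V} (p : Quiver.Path i j) (f : j ⟶ k) :
    ofPath F (p.cons f) = arrow F f * ofPath F p := by
  rw [arrow, ofPath_mul_ofPath]
  rfl

variable [Fintype V]

open Classical in
/-- The coefficient of the path of length zero at a vertex. -/
def character (v : V) : PathAlgebra F V →ₐ[F] F :=
  lift (fun w => if w = v then 1 else 0) (fun _ _ _ => 0) (by intro i; simp)
    (by intro i j hij; by_cases h : i = v <;> simp [h]; rintro rfl; exact hij h) (by simp)
    (by simp)

theorem character_vertex_self (v : V) : character F v (vertex F v) = 1 := by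
  simp [character, lift_vertex]

theorem character_vertex_of_ne {v w : V} (h : w ≠ v) : character F v (vertex F w) = 0 := by
  simp [character, lift_vertex, h]

theorem character_cons (v : V) {i j k : V} (p : Quiver.Path i j) (f : j ⟶ k) :
    character F v (ofPath F (p.cons f)) = 0 := by
  rw [character, lift_ofPath]
  simp [pathValue]

variable {F}

theorem mul_mem_longPaths {m n : ℕ} {x y : PathAlgebra F V} (hx : x ∈ longPaths F V m)
    (hy : y ∈ longPaths F V n) : x * y ∈ longPaths F V (m + n) := by
  induction hx using Submodule.span_induction with
  | zero => simp
  | add x x' _ _ hx hx' => rw [add_mul]; exact add_mem hx hx'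
  | smul c x _ hx => rw [smul_mul_assoc]; exact Submodule.smul_mem _ c hx
  | mem x hx =>
  induction hy using Submodule.span_induction with
  | zero => simp
  | add y y' _ _ hy hy' => rw [mul_add]; exact add_mem hy hy'
  | smul c y _ hy => rw [mul_smul_comm]; exact Submodule.smul_mem _ c hy
  | mem y hy =>
  obtain ⟨i, j, p, hp, rfl⟩ := hx
  obtain ⟨k, l, q, hq, rfl⟩ := hy
  by_cases h : l = i
  · subst h
    rw [ofPath_mul_ofPath]
    exact ofPath_mem_longPaths _ (by rw [Quiver.Path.length_comp]; omega)
  · rw [ofPath_mul_ofPath_of_ne _ _ h]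
    exact zero_mem _

theorem pow_mem_longPaths {n : ℕ} {x : PathAlgebra F V} (hx : x ∈ longPaths F V n) (k : ℕ) :
    x ^ (k + 1) ∈ longPaths F V ((k + 1) * n) := by
  induction k with
  | zero => simpa using hx
  | succ k ih => rw [pow_succ, add_one_mul]; exact mul_mem_longPaths ih hx

theorem sub_sum_character_mem (x : PathAlgebra F V) :
    x - ∑ v, character F v x • vertex F v ∈ longPaths F V 1 := by
  classical
  induction x using induction with
  | zero => simp
  | add x y hx hy =>
    convert add_mem hx hy using 1
    simp only [map_add, add_smul, Finset.sum_add_distrib]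
    abel
  | smul c x hx =>
    convert Submodule.smul_mem _ c hx using 1
    simp only [map_smul, smul_sub, Finset.smul_sum, smul_assoc]
  | path i j p =>
    cases p with
    | nil =>
      have h : ∑ v, character F v (vertex F i) • vertex F v = vertex F i := by
        rw [Finset.sum_eq_single i]
        · rw [character_vertex_self, one_smul]
        · intro v _ hv
          rw [character_vertex_of_ne F hv.symm, zero_smul]
        · simp
      change vertex F i - ∑ v, character F v (vertex F i) • vertex F v ∈ _
      rw [h, sub_self]
      exact zero_mem _
    | cons p f =>
      simp only [character_cons, zero_smul, Finset.sum_const_zero, sub_zero]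
      exact ofPath_mem_longPaths _ (by simp)

theorem mem_longPaths_one_of_character {x : PathAlgebra F V} (hx : ∀ v, character F v x = 0) :
    x ∈ longPaths F V 1 := by
  simpa [hx] using sub_sum_character_mem x

/-- If the arrows strictly increase a bounded function on the vertices, then the elements killed
by all the characters are nilpotent. -/
theorem isNilpotent_of_character (h : V → ℕ) (hh : ∀ i j, (i ⟶ j) → h i < h j) {n : ℕ}
    (hn : ∀ i, h i ≤ n) {x : PathAlgebra F V} (hx : ∀ v, character F v x = 0) :
    IsNilpotent x := by
  have hlen : ∀ (i j : V) (p : Quiver.Path i j), h i + p.length ≤ h j := by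
    intro i j p
    induction p with
    | nil => simp
    | cons p f ih => have := hh _ _ f; simp only [Quiver.Path.length_cons]; omega
  have hbot : longPaths F V (n + 1) = ⊥ := by
    refine Submodule.span_eq_bot.mpr ?_
    rintro _ ⟨i, j, p, hp, rfl⟩
    have := hlen i j p
    have := hn j
    omega
  refine ⟨n + 1, ?_⟩
  have := pow_mem_longPaths (mem_longPaths_one_of_character hx) n
  rwa [mul_one, hbot, Submodule.mem_bot] at this

end character

end PathAlgebra

namespace E7Quiver

open Vertex PathAlgebra

variable (F : Type*) [Field F]

/-- A function on the vertices that is strictly increased by the arrows. -/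
def height : Vertex → ℕ
  | v1 => 0
  | v2 => 1
  | v3 => 2
  | v4 => 3
  | v5 => 2
  | v6 => 1
  | v7 => 2

variable {F}

theorem isNilpotent_of_character {x : PathAlgebra F Vertex}
    (hx : ∀ v, character F v x = 0) : IsNilpotent x := by
  refine PathAlgebra.isNilpotent_of_character height (fun i j (f : Arrow i j) => ?_) (n := 3) ?_ hx
  · cases f <;> decide
  · intro i
    cases i <;> decide

theorem vertex_mem_mergedSubalgebra {i : Vertex} (h4 : i ≠ v4) (h7 : i ≠ v7) :
    vertex F i ∈ mergedSubalgebra F :=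
  Algebra.subset_adjoin (Or.inl (Or.inl ⟨i, h4, h7, rfl⟩))

theorem merged_mem_mergedSubalgebra : vertex F v4 + vertex F v7 ∈ mergedSubalgebra F :=
  Algebra.subset_adjoin (Or.inl (Or.inr rfl))

theorem cons_mem_mergedSubalgebra {i j k : Vertex} (p : Quiver.Path i j) (f : j ⟶ k) :
    ofPath F (p.cons f) ∈ mergedSubalgebra F :=
  Algebra.subset_adjoin (Or.inr ⟨i, k, p.cons f, by simp, rfl⟩)

theorem sub_smul_vertex_mem_mergedSubalgebra (x : PathAlgebra F Vertex) :
    x - (character F v4 x - character F v7 x) • vertex F v4 ∈ mergedSubalgebra F := by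
  induction x using PathAlgebra.induction with
  | zero => simp
  | add x y hx hy =>
    convert add_mem hx hy using 1
    simp only [map_add, add_smul, sub_smul]
    abel
  | smul c x hx =>
    convert Subalgebra.smul_mem _ hx c using 1
    simp only [map_smul, smul_sub, sub_smul, smul_assoc]
  | path i j p =>
    cases p with
    | cons p f =>
      simpa only [character_cons, sub_self, zero_smul, sub_zero] using
        cons_mem_mergedSubalgebra p f
    | nil =>
      change vertex F i - (character F v4 (vertex F i) - character F v7 (vertex F i)) •
        vertex F v4 ∈ _
      by_cases h4 : i = v4
      · subst h4
        rw [character_vertex_self, character_vertex_of_ne F (by decide)]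
        simp
      by_cases h7 : i = v7
      · subst h7
        rw [character_vertex_self, character_vertex_of_ne F (by decide)]
        simpa [add_comm] using merged_mem_mergedSubalgebra (F := F)
      · rw [character_vertex_of_ne F h4, character_vertex_of_ne F h7, sub_self, zero_smul, sub_zero]
        exact vertex_mem_mergedSubalgebra h4 h7

theorem character_four_eq_seven {x : PathAlgebra F Vertex} (hx : x ∈ mergedSubalgebra F) :
    character F v4 x = character F v7 x := by
  have h : mergedSubalgebra F ≤ AlgHom.equalizer (character F v4) (character F v7) := by
    refine Algebra.adjoin_le ?_
    rintro x ((⟨i, h4, h7, rfl⟩ | rfl) | ⟨i, j, p, hp, rfl⟩)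
    · simp [character_vertex_of_ne F h4, character_vertex_of_ne F h7]
    · simp only [SetLike.mem_coe, AlgHom.mem_equalizer, map_add, character_vertex_self]
      rw [character_vertex_of_ne F (by decide), character_vertex_of_ne F (by decide), add_comm]
    · cases p with
      | nil => simp at hp
      | cons p f => simp [character_cons]
  exact h hx

theorem mem_mergedSubalgebra_iff {x : PathAlgebra F Vertex} :
    x ∈ mergedSubalgebra F ↔ character F v4 x = character F v7 x := by
  refine ⟨character_four_eq_seven, fun h => ?_⟩
  simpa [h] using sub_smul_vertex_mem_mergedSubalgebra x

variable (F) in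
theorem finrank_quotient_mergedSubalgebra :
    Module.finrank F (PathAlgebra F Vertex ⧸ Subalgebra.toSubmodule (mergedSubalgebra F)) = 1 := by
  let l : PathAlgebra F Vertex →ₗ[F] F :=
    (character F v4).toLinearMap - (character F v7).toLinearMap
  have hl : Subalgebra.toSubmodule (mergedSubalgebra F) = LinearMap.ker l := by
    ext x
    simp [l, mem_mergedSubalgebra_iff, sub_eq_zero]
  have hs : Function.Surjective l := fun c =>
    ⟨c • vertex F v4, by
      simp [l, character_vertex_self, character_vertex_of_ne F (show v4 ≠ v7 by decide)]⟩
  rw [hl, (l.quotKerEquivOfSurjective hs).finrank_eq, Module.finrank_self]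

variable (F) in
theorem image_jacobson_mergedSubalgebra :
    (mergedSubalgebra F).val '' (Ring.jacobson (mergedSubalgebra F) : Set (mergedSubalgebra F)) =
      (Ring.jacobson (PathAlgebra F Vertex) : Set (PathAlgebra F Vertex)) := by
  have hA := mem_jacobson_iff_of_characters
    (fun v => (character F v).comp (mergedSubalgebra F).val) fun x hx =>
      (IsNilpotent.map_iff (f := (mergedSubalgebra F).val) Subtype.val_injective).mp
        (isNilpotent_of_character hx)
  have hB := mem_jacobson_iff_of_characters (character F) fun x => isNilpotent_of_character
  ext x
  simp only [Set.mem_image, SetLike.mem_coe, hA, hB, AlgHom.comp_apply]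
  constructor
  · rintro ⟨y, hy, rfl⟩
    exact hy
  · intro hx
    exact ⟨⟨x, mem_mergedSubalgebra_iff.mpr (by rw [hx, hx])⟩, hx, rfl⟩

end E7Quiver

namespace PathAlgebra

variable {F V : Type*} [Field F] [Quiver V]

theorem arrow_mul_vertex {i j : V} (f : i ⟶ j) : arrow F f * vertex F i = arrow F f := by
  rw [arrow, vertex, ofPath_mul_ofPath, Quiver.Path.nil_comp]

theorem vertex_mul_arrow {i j : V} (f : i ⟶ j) : vertex F j * arrow F f = arrow F f := by
  rw [arrow, vertex, ofPath_mul_ofPath, Quiver.Path.comp_nil]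

theorem vertex_mul_self (i : V) : vertex F i * vertex F i = vertex F i := by
  rw [vertex, ofPath_mul_ofPath, Quiver.Path.nil_comp]

theorem vertex_mul_vertex_of_ne {i j : V} (h : i ≠ j) : vertex F i * vertex F j = 0 :=
  ofPath_mul_ofPath_of_ne _ _ h.symm

theorem vertex_mul_arrow_of_ne {i j k : V} (f : i ⟶ j) (h : j ≠ k) :
    vertex F k * arrow F f = 0 :=
  ofPath_mul_ofPath_of_ne _ _ h

theorem arrow_mul_vertex_of_ne {i j k : V} (f : i ⟶ j) (h : k ≠ i) :
    arrow F f * vertex F k = 0 :=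
  ofPath_mul_ofPath_of_ne _ _ h

theorem arrow_mul_arrow_of_ne {i j k l : V} (f : i ⟶ j) (g : k ⟶ l) (h : j ≠ k) :
    arrow F g * arrow F f = 0 :=
  ofPath_mul_ofPath_of_ne _ _ h

end PathAlgebra

namespace LoopQuiver

open Vertex PathAlgebra

def α : (v1 : Vertex) ⟶ v2 := Arrow.α

def β : (v2 : Vertex) ⟶ v3 := Arrow.β

def η : (v6 : Vertex) ⟶ v5 := Arrow.η

variable (F : Type*) [Field F]

/-- Representatives of the nonzero residue classes of paths that terminate at a vertex. -/
def pathsTo : Vertex → Set (PathAlgebra F Vertex)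
  | v1 => {vertex F v1}
  | v2 => {vertex F v2, arrow F α}
  | v3 => {vertex F v3, arrow F β, arrow F β * arrow F α}
  | v4 => {vertex F v4, arrow F γ, arrow F γ * arrow F β, arrow F γ * (arrow F β * arrow F α),
      arrow F δ, arrow F δ * arrow F η, arrow F ε}
  | v5 => {vertex F v5, arrow F η}
  | v6 => {vertex F v6}

/-- Representatives of the nonzero residue classes of paths. -/
def paths : Fin 16 → PathAlgebra F Vertex :=
  ![vertex F v1, vertex F v2, vertex F v3, vertex F v4, vertex F v5, vertex F v6,
    arrow F α, arrow F β, arrow F γ, arrow F δ, arrow F η, arrow F ε, arrow F β * arrow F α,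
    arrow F γ * arrow F β, arrow F γ * (arrow F β * arrow F α), arrow F δ * arrow F η]

variable {F}

theorem pathsTo_subset (i : Vertex) : pathsTo F i ⊆ Set.range (paths F) := by
  have h : ∀ k, paths F k ∈ Set.range (paths F) := fun k => ⟨k, rfl⟩
  cases i
  · rintro _ rfl
    exact h 0
  · rintro _ (rfl | rfl)
    exacts [h 1, h 6]
  · rintro _ (rfl | rfl | rfl)
    exacts [h 2, h 7, h 12]
  · rintro _ (rfl | rfl | rfl | rfl | rfl | rfl | rfl)
    exacts [h 3, h 8, h 13, h 14, h 9, h 15, h 11]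
  · rintro _ (rfl | rfl)
    exacts [h 4, h 10]
  · rintro _ rfl
    exact h 5

variable {S : Type*} [Ring S] [Algebra F S]

section

variable (φ : PathAlgebra F Vertex →ₐ[F] S) (hεε : φ (arrow F ε) * φ (arrow F ε) = 0)
  (hεγ : φ (arrow F ε) * φ (arrow F γ) = 0) (hεδ : φ (arrow F ε) * φ (arrow F δ) = 0)

include hεε hεγ hεδ

theorem map_arrow_mul_mem {i j : Vertex} (f : i ⟶ j) {x : PathAlgebra F Vertex}
    (hx : x ∈ pathsTo F i) :
    φ (arrow F f * x) ∈ Submodule.span F (φ '' pathsTo F j) := by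
  have key : ∀ y ∈ pathsTo F j, arrow F f * x = y →
      φ (arrow F f * x) ∈ Submodule.span F (φ '' pathsTo F j) := by
    rintro y hy rfl
    exact Submodule.subset_span ⟨_, hy, rfl⟩
  change Arrow i j at f
  cases f
  · obtain rfl := hx
    exact key _ (Or.inr rfl) (arrow_mul_vertex _)
  · rcases hx with rfl | rfl
    · exact key _ (Or.inr (Or.inl rfl)) (arrow_mul_vertex _)
    · exact key _ (Or.inr (Or.inr rfl)) rfl
  · rcases hx with rfl | rfl | rfl
    · exact key _ (Or.inr (Or.inl rfl)) (arrow_mul_vertex _)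
    · exact key _ (Or.inr (Or.inr (Or.inl rfl))) rfl
    · exact key _ (Or.inr (Or.inr (Or.inr (Or.inl rfl)))) rfl
  · rcases hx with rfl | rfl
    · exact key _ (Or.inr (Or.inr (Or.inr (Or.inr (Or.inl rfl))))) (arrow_mul_vertex _)
    · exact key _ (Or.inr (Or.inr (Or.inr (Or.inr (Or.inr (Or.inl rfl)))))) rfl
  · obtain rfl := hx
    exact key _ (Or.inr rfl) (arrow_mul_vertex _)
  · have h0 : ∀ y, φ (arrow F ε) * φ y = 0 →
        φ (arrow F ε * y) ∈ Submodule.span F (φ '' pathsTo F v4) := fun y hy => by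
      rw [map_mul, hy]
      exact zero_mem _
    rcases hx with rfl | rfl | rfl | rfl | rfl | rfl | rfl
    · exact key _ (Or.inr (Or.inr (Or.inr (Or.inr (Or.inr (Or.inr rfl)))))) (arrow_mul_vertex _)
    · exact h0 _ hεγ
    · exact h0 _ (by rw [map_mul, ← mul_assoc, hεγ, zero_mul])
    · exact h0 _ (by rw [map_mul, ← mul_assoc, hεγ, zero_mul])
    · exact h0 _ hεδ
    · exact h0 _ (by rw [map_mul, ← mul_assoc, hεδ, zero_mul])
    · exact h0 _ hεε

theorem map_ofPath_mem {i j : Vertex} (p : Quiver.Path i j) :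
    φ (ofPath F p) ∈ Submodule.span F (φ '' pathsTo F j) := by
  induction p with
  | nil =>
    refine Submodule.subset_span ⟨vertex F i, ?_, rfl⟩
    cases i <;> simp [pathsTo]
  | @cons j k p f ih =>
    rw [ofPath_cons, map_mul]
    refine (Submodule.span_le (p := (Submodule.span F (φ '' pathsTo F k)).comap
      (LinearMap.mulLeft F (φ (arrow F f))))).mpr ?_ ih
    rintro _ ⟨x, hx, rfl⟩
    simpa using map_arrow_mul_mem φ hεε hεγ hεδ f hx

theorem map_mem_span_paths (x : PathAlgebra F Vertex) :
    φ x ∈ Submodule.span F (Set.range (φ ∘ paths F)) := by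
  induction x using PathAlgebra.induction with
  | zero => simp
  | add x y hx hy => rw [map_add]; exact add_mem hx hy
  | smul c x hx => rw [map_smul]; exact Submodule.smul_mem _ c hx
  | path i j p =>
    refine Submodule.span_mono ?_ (map_ofPath_mem φ hεε hεγ hεδ p)
    rw [Set.range_comp]
    exact Set.image_mono (pathsTo_subset j)

theorem map_relations {x : PathAlgebra F Vertex} (hx : x ∈ (relations F).asIdeal) : φ x = 0 := by
  have h : relations F ≤ TwoSidedIdeal.ker φ := by
    refine TwoSidedIdeal.span_le.mpr ?_
    rintro _ (rfl | rfl | rfl) <;> simpa [TwoSidedIdeal.mem_ker]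
  exact (TwoSidedIdeal.mem_ker φ).mp (h hx)

end

/-- A homomorphism that satisfies the relations factors through an injective homomorphism if the
images of the paths are linearly independent. -/
theorem injective_liftₐ (φ : PathAlgebra F Vertex →ₐ[F] S)
    (hφ : ∀ x ∈ (relations F).asIdeal, φ x = 0) (hli : LinearIndependent F (φ ∘ paths F)) :
    Function.Injective (Ideal.Quotient.liftₐ (relations F).asIdeal φ hφ) := by
  let π := Ideal.Quotient.mkₐ F (relations F).asIdeal
  have hπ : ∀ x ∈ ({arrow F ε * arrow F ε, arrow F ε * arrow F γ, arrow F ε * arrow F δ} :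
      Set (PathAlgebra F Vertex)), π x = 0 := fun x hx =>
    Ideal.Quotient.eq_zero_iff_mem.mpr (TwoSidedIdeal.subset_span hx)
  rw [injective_iff_map_eq_zero]
  intro y hy
  obtain ⟨x, rfl⟩ := Ideal.Quotient.mkₐ_surjective F (relations F).asIdeal y
  have hx := map_mem_span_paths π (by simpa using hπ _ (Or.inl rfl))
    (by simpa using hπ _ (Or.inr (Or.inl rfl))) (by simpa using hπ _ (Or.inr (Or.inr rfl))) x
  obtain ⟨c, hc⟩ := (Submodule.mem_span_range_iff_exists_fun F).mp hx
  change π x = 0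
  have hsum : ∑ i, c i • (φ ∘ paths F) i = 0 := by
    have := congrArg (Ideal.Quotient.liftₐ (relations F).asIdeal φ hφ) hc
    rw [map_sum] at this
    rw [← hy]
    refine Eq.trans (Finset.sum_congr rfl fun i _ => ?_) this
    rw [map_smul]
    rfl
  rw [← hc]
  refine Finset.sum_eq_zero fun i _ => ?_
  rw [Fintype.linearIndependent_iff.mp hli c hsum i, zero_smul]

end LoopQuiver

namespace E7Quiver

open Vertex PathAlgebra

variable (F : Type*) [Field F]

def α : (v1 : Vertex) ⟶ v2 := Arrow.α

def β : (v2 : Vertex) ⟶ v3 := Arrow.β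

def γ : (v3 : Vertex) ⟶ v4 := Arrow.γ

def δ : (v5 : Vertex) ⟶ v4 := Arrow.δ

def η : (v6 : Vertex) ⟶ v5 := Arrow.η

def ρ : (v7 : Vertex) ⟶ v4 := Arrow.ρ

/-- The idempotents of the merged subalgebra. -/
def mergedVertex : LoopQuiver.Vertex → PathAlgebra F Vertex
  | .v1 => vertex F v1
  | .v2 => vertex F v2
  | .v3 => vertex F v3
  | .v4 => vertex F v4 + vertex F v7
  | .v5 => vertex F v5
  | .v6 => vertex F v6

/-- The arrows of the merged subalgebra: `ρ` becomes a loop. -/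
def mergedArrow : ∀ i j : LoopQuiver.Vertex, LoopQuiver.Arrow i j → PathAlgebra F Vertex
  | _, _, .α => arrow F α
  | _, _, .β => arrow F β
  | _, _, .γ => arrow F γ
  | _, _, .δ => arrow F δ
  | _, _, .η => arrow F η
  | _, _, .ε => arrow F ρ

variable {F}

theorem mergedArrow_mul_mergedVertex (i j : LoopQuiver.Vertex) (f : LoopQuiver.Arrow i j) :
    mergedArrow F i j f * mergedVertex F i = mergedArrow F i j f := by
  cases f
  case ε =>
    simp only [mergedArrow, mergedVertex, mul_add, arrow_mul_vertex]
    rw [arrow_mul_vertex_of_ne ρ (by decide), zero_add]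
  all_goals exact arrow_mul_vertex _

variable (F) in
/-- The homomorphism from the path algebra of the quiver with a loop onto the merged subalgebra. -/
def mergeHom : PathAlgebra F LoopQuiver.Vertex →ₐ[F] PathAlgebra F Vertex :=
  lift (mergedVertex F) (mergedArrow F)
    (by
      intro i
      cases i
      case v4 =>
        simp only [mergedVertex, mul_add, add_mul, vertex_mul_self]
        rw [vertex_mul_vertex_of_ne (by decide), vertex_mul_vertex_of_ne (by decide), add_zero,
          zero_add]
      all_goals exact vertex_mul_self _)
    (by
      intro i j hij
      cases i <;> cases j <;> first
        | exact absurd rfl hij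
        | simp [mergedVertex, mul_add, add_mul, vertex_mul_vertex_of_ne])
    (by
      rw [one_eq]
      change ∑ i ∈ {.v1, .v2, .v3, .v4, .v5, .v6}, mergedVertex F i =
        ∑ i ∈ {v1, v2, v3, v4, v5, v6, v7}, vertex F i
      simp [mergedVertex]
      abel)
    (by
      have h7 : ∀ {i : Vertex} (f : i ⟶ v4),
          (vertex F v4 + vertex F v7) * arrow F f = arrow F f := fun f => by
        rw [add_mul, vertex_mul_arrow, vertex_mul_arrow_of_ne f (by decide), add_zero]
      rintro i j (_ | _)
      case γ => exact h7 _
      case δ => exact h7 _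
      case ε => exact h7 _
      all_goals exact vertex_mul_arrow _)

theorem mergeHom_vertex (i : LoopQuiver.Vertex) : mergeHom F (vertex F i) = mergedVertex F i :=
  lift_vertex ..

theorem mergeHom_arrow {i j : LoopQuiver.Vertex} (f : i ⟶ j) :
    mergeHom F (arrow F f) = mergedArrow F i j f :=
  lift_arrow _ _ _ _ _ (mergedArrow_mul_mergedVertex i j f)

theorem character_mergedArrow (v : Vertex) {i j : LoopQuiver.Vertex} (f : LoopQuiver.Arrow i j) :
    character F v (mergedArrow F i j f) = 0 := by
  cases f <;> exact character_cons F v .nil _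

variable (F) in
theorem mergeHom_relations (x : PathAlgebra F LoopQuiver.Vertex)
    (hx : x ∈ (LoopQuiver.relations F).asIdeal) : mergeHom F x = 0 := by
  have h : ∀ {i : Vertex} (f : i ⟶ v4), arrow F ρ * arrow F f = 0 := fun f =>
    arrow_mul_arrow_of_ne f ρ (by decide)
  have hε := mergeHom_arrow (F := F) LoopQuiver.ε
  refine LoopQuiver.map_relations (mergeHom F) ?_ ?_ ?_ hx
  · rw [hε]
    exact h ρ
  · rw [hε, mergeHom_arrow LoopQuiver.γ]
    exact h γ
  · rw [hε, mergeHom_arrow LoopQuiver.δ]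
    exact h δ

variable (F) in
theorem range_mergeHom : (mergeHom F).range = mergedSubalgebra F := by
  apply le_antisymm
  · rintro _ ⟨x, rfl⟩
    rw [mem_mergedSubalgebra_iff]
    suffices h : (character F v4).comp (mergeHom F) = (character F v7).comp (mergeHom F) from
      DFunLike.congr_fun h x
    refine AlgHom.ext fun x => ?_
    induction x using PathAlgebra.induction with
    | zero => simp
    | add x y hx hy => simp only [map_add, hx, hy]
    | smul c x hx => simp only [map_smul, hx]
    | path i j p =>
      cases p with
      | nil =>
        change character F v4 (mergeHom F (vertex F i)) = character F v7 (mergeHom F (vertex F i))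
        rw [mergeHom_vertex, ← mem_mergedSubalgebra_iff]
        cases i
        case v4 => exact merged_mem_mergedSubalgebra
        all_goals exact vertex_mem_mergedSubalgebra (by decide) (by decide)
      | @cons j k p f =>
        simp only [AlgHom.comp_apply, ofPath_cons, map_mul]
        have h : ∀ v, character F v (mergeHom F (arrow F f)) = 0 := by
          intro v
          rw [mergeHom_arrow]
          exact character_mergedArrow v f
        rw [h, h, zero_mul, zero_mul]
  · have harrow : ∀ {i j : Vertex} (f : i ⟶ j), arrow F f ∈ (mergeHom F).range := by
      intro i j f
      change Arrow i j at f
      cases f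
      exacts [⟨_, mergeHom_arrow LoopQuiver.α⟩, ⟨_, mergeHom_arrow LoopQuiver.β⟩,
        ⟨_, mergeHom_arrow LoopQuiver.γ⟩, ⟨_, mergeHom_arrow LoopQuiver.δ⟩,
        ⟨_, mergeHom_arrow LoopQuiver.η⟩, ⟨_, mergeHom_arrow LoopQuiver.ε⟩]
    refine Algebra.adjoin_le ?_
    rintro x ((⟨i, h4, h7, rfl⟩ | rfl) | ⟨i, j, p, hp, rfl⟩)
    · cases i
      exacts [⟨_, mergeHom_vertex .v1⟩, ⟨_, mergeHom_vertex .v2⟩, ⟨_, mergeHom_vertex .v3⟩,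
        absurd rfl h4, ⟨_, mergeHom_vertex .v5⟩, ⟨_, mergeHom_vertex .v6⟩, absurd rfl h7]
    · exact ⟨_, mergeHom_vertex .v4⟩
    · induction p with
      | nil => simp at hp
      | cons p f ih =>
        rw [ofPath_cons]
        cases p with
        | nil =>
          have := harrow f
          rw [← arrow_mul_vertex] at this
          exact this
        | cons p g => exact mul_mem (harrow f) (ih (by simp))

/-- The sum of the coefficients of the paths between two given vertices. -/
def entry (i j : Vertex) : PathAlgebra F Vertex →ₗ[F] F :=
  (basis F).constr F fun p => if p.1 = i ∧ p.2.1 = j then 1 else 0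

theorem entry_ofPath (i j : Vertex) {k l : Vertex} (p : Quiver.Path k l) :
    entry i j (ofPath F p) = if k = i ∧ l = j then 1 else 0 := by
  simp [entry, ofPath, Module.Basis.constr_basis]

/-- The source of a path in the merged quiver. -/
def source : Fin 16 → Vertex :=
  ![v1, v2, v3, v4, v5, v6, v1, v2, v3, v5, v6, v7, v1, v2, v1, v6]

/-- The target of a path in the merged quiver. -/
def target : Fin 16 → Vertex :=
  ![v1, v2, v3, v4, v5, v6, v2, v3, v4, v4, v5, v4, v3, v4, v4, v4]

theorem entry_mergeHom_paths (j k : Fin 16) :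
    entry (source j) (target j) (mergeHom F (LoopQuiver.paths F k)) = if k = j then 1 else 0 := by
  have hm : ∀ {x y : PathAlgebra F LoopQuiver.Vertex} {x' y' : PathAlgebra F Vertex},
      mergeHom F x = x' → mergeHom F y = y' → mergeHom F (x * y) = x' * y' := by
    rintro x y _ _ rfl rfl
    exact map_mul _ _ _
  have hp : ∀ {x : PathAlgebra F LoopQuiver.Vertex} {a b : Vertex} (p : Quiver.Path a b)
      {k : Fin 16}, mergeHom F x = ofPath F p →
      (∀ j, a = source j ∧ b = target j ↔ k = j) →
      entry (source j) (target j) (mergeHom F x) = if k = j then 1 else 0 := by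
    intro x a b p k hx hk
    rw [hx, entry_ofPath]
    exact if_congr (hk j) rfl rfl
  have hα := mergeHom_arrow (F := F) LoopQuiver.α
  have hβ := mergeHom_arrow (F := F) LoopQuiver.β
  have hγ := mergeHom_arrow (F := F) LoopQuiver.γ
  have hδ := mergeHom_arrow (F := F) LoopQuiver.δ
  have hη := mergeHom_arrow (F := F) LoopQuiver.η
  have hε := mergeHom_arrow (F := F) LoopQuiver.ε
  have hβα := (hm hβ hα).trans (ofPath_mul_ofPath β.toPath α.toPath)
  have hv : ∀ i, mergeHom F (vertex F i) = mergedVertex F i := mergeHom_vertex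
  fin_cases k
  · exact hp _ (hv .v1) (by decide)
  · exact hp _ (hv .v2) (by decide)
  · exact hp _ (hv .v3) (by decide)
  · have h7 : ∀ j, ¬ (v7 = source j ∧ v7 = target j) := by decide
    have h4 : ∀ j, v4 = source j ∧ v4 = target j ↔ 3 = j := by decide
    change entry _ _ (mergeHom F (vertex F .v4)) = if 3 = j then 1 else 0
    rw [hv, mergedVertex, map_add, vertex, vertex, entry_ofPath, entry_ofPath, if_neg (h7 j),
      add_zero]
    exact if_congr (h4 j) rfl rfl
  · exact hp _ (hv .v5) (by decide)
  · exact hp _ (hv .v6) (by decide)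
  · exact hp _ hα (by decide)
  · exact hp _ hβ (by decide)
  · exact hp _ hγ (by decide)
  · exact hp _ hδ (by decide)
  · exact hp _ hη (by decide)
  · exact hp _ hε (by decide)
  · exact hp _ hβα (by decide)
  · exact hp _ ((hm hγ hβ).trans (ofPath_mul_ofPath γ.toPath β.toPath)) (by decide)
  · exact hp _ ((hm hγ hβα).trans (ofPath_mul_ofPath γ.toPath _)) (by decide)
  · exact hp _ ((hm hδ hη).trans (ofPath_mul_ofPath δ.toPath η.toPath)) (by decide)

theorem linearIndependent_mergeHom_paths :
    LinearIndependent F (mergeHom F ∘ LoopQuiver.paths F) := by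
  rw [Fintype.linearIndependent_iff]
  intro c hc j
  have h := congrArg (entry (source j) (target j)) hc
  simpa only [map_sum, map_smul, smul_eq_mul, map_zero, Function.comp_apply, entry_mergeHom_paths,
    mul_ite, mul_one, mul_zero, Finset.sum_ite_eq', Finset.mem_univ, if_true] using h

variable (F) in
/-- The merged subalgebra is the path algebra of the quiver with a loop, modulo the relations. -/
def mergedSubalgebraEquiv :
    (PathAlgebra F LoopQuiver.Vertex ⧸ (LoopQuiver.relations F).asIdeal) ≃ₐ[F]
      mergedSubalgebra F :=
  (AlgEquiv.ofInjective _ (LoopQuiver.injective_liftₐ (mergeHom F) (mergeHom_relations F)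
    linearIndependent_mergeHom_paths)).trans
    (Subalgebra.equivOfEq _ _ (by
      rw [← range_mergeHom]
      ext x
      constructor
      · rintro ⟨y, rfl⟩
        obtain ⟨y, rfl⟩ := Ideal.Quotient.mkₐ_surjective F _ y
        exact ⟨y, rfl⟩
      · rintro ⟨y, rfl⟩
        exact ⟨Ideal.Quotient.mkₐ F _ y, rfl⟩))

end E7Quiver

/-- A sum over all permutations of a function of the list of their values. -/
theorem sum_perm_eq_sum_permutations {M : Type*} [AddCommMonoid M] (n : ℕ) (G : List ℕ → M) :
    ∑ σ : Equiv.Perm (Fin n), G (List.ofFn fun i => (σ i : ℕ)) =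
      ((List.range n).permutations'.map G).sum := by
  have hinj : Function.Injective fun σ : Equiv.Perm (Fin n) => List.ofFn fun i => (σ i : ℕ) := by
    intro σ τ h
    ext i
    exact congrFun (List.ofFn_injective h) i
  have hmem : ∀ σ : Equiv.Perm (Fin n),
      (List.ofFn fun i => (σ i : ℕ)) ∈ (List.range n).permutations := by
    intro σ
    rw [List.mem_permutations]
    refine (List.perm_ext_iff_of_nodup ?_ List.nodup_range).mpr fun k => ?_
    · exact List.nodup_ofFn.mpr (Fin.val_injective.comp σ.injective)
    · simp only [List.mem_ofFn, List.mem_range]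
      constructor
      · rintro ⟨i, rfl⟩
        exact (σ i).2
      · intro hk
        exact ⟨σ.symm ⟨k, hk⟩, by simp⟩
  have hnd : (List.range n).permutations.Nodup := List.nodup_permutations _ List.nodup_range
  rw [← ((List.permutations_perm_permutations' _).map G).sum_eq,
    ← List.sum_toFinset G hnd]
  refine Finset.sum_nbij (fun σ => List.ofFn fun i => (σ i : ℕ)) (by simpa using hmem)
    hinj.injOn ?_ (fun _ _ => rfl)
  refine Finset.surjOn_of_injOn_of_card_le _ (by simpa [Set.MapsTo] using hmem) hinj.injOn ?_
  rw [List.toFinset_card_of_nodup hnd, List.length_permutations, List.length_range,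
    Finset.card_univ, Fintype.card_perm, Fintype.card_fin]

namespace Descent

open MulOpposite

variable (F : Type*) [Field F]

theorem coeff_eq_of_des_eq {n : ℕ} {x : MonoidAlgebra F (SymGroup n)}
    (hx : x ∈ descentAlgebra F n) {v w : SymGroup n} (h : des v = des w) :
    x.coeff v = x.coeff w := by
  replace hx : x ∈ Submodule.span F (Set.range (Xi F (n := n))) := hx
  induction hx using Submodule.span_induction with
  | zero => rfl
  | add x y _ _ ihx ihy =>
    simp only [MonoidAlgebra.coeff_add, Finsupp.add_apply, ihx, ihy]
  | smul c x _ ih => simp only [MonoidAlgebra.coeff_smul, Finsupp.smul_apply, ih]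
  | mem x hx =>
    classical
    obtain ⟨q, rfl⟩ := hx
    have hXi : ∀ u : SymGroup n, (Xi F q).coeff u = if des u ⊆ ends q then 1 else 0 := by
      intro u
      simp only [Xi, isMinRep_iff, incrOn_iff_des, MonoidAlgebra.coeff_sum,
        Finsupp.finsetSum_apply, MonoidAlgebra.of_apply, MonoidAlgebra.coeff_single]
      rw [Finset.sum_filter, Finset.sum_eq_single u.unop]
      · simp
      · intro σ _ hσ
        have : op σ ≠ u := fun h => hσ (by rw [← h, unop_op])
        simp [this]
      · simp
    rw [hXi, hXi, h]

theorem coeff_mul_op {n : ℕ} (x y : MonoidAlgebra F (SymGroup n)) (w : Equiv.Perm (Fin n)) :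
    (x * y).coeff (op w) = ∑ σ, x.coeff (op σ) * y.coeff (op (w * σ⁻¹)) := by
  let _ : Fintype (SymGroup n) := Fintype.ofEquiv _ MulOpposite.opEquiv
  rw [MonoidAlgebra.coeff_mul_apply_left, Finsupp.sum_fintype _ _ (by simp),
    ← MulOpposite.opEquiv.sum_comp]
  rfl

/-- The descent set of a permutation, as a sum of powers of two. -/
def descentCode (σ : Equiv.Perm (Fin 5)) : ℕ := ∑ i ∈ des (op σ), 2 ^ (i : ℕ)

/-- The descent set of a word of length five, as a sum of powers of two. -/
def wordCode (f : ℕ → ℕ) : ℕ :=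
  (if f 1 < f 0 then 1 else 0) + (if f 2 < f 1 then 2 else 0) +
    (if f 3 < f 2 then 4 else 0) + (if f 4 < f 3 then 8 else 0)

theorem descentCode_eq_wordCode (σ : Equiv.Perm (Fin 5)) (f : ℕ → ℕ)
    (h : ∀ i : Fin 5, f i = σ i) : descentCode σ = wordCode f := by
  have h0 := h 0
  have h1 := h 1
  have h2 := h 2
  have h3 := h 3
  have h4 := h 4
  simp only [Fin.val_zero, Fin.val_one, Fin.val_two, show ((3 : Fin 5) : ℕ) = 3 from rfl,
    show ((4 : Fin 5) : ℕ) = 4 from rfl] at h0 h1 h2 h3 h4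
  have hs : ∀ a b : Fin 5, (b : ℕ) = a + 1 →
      ((∃ j : Fin 5, (j : ℕ) = a + 1 ∧ σ j < σ a) ↔ σ b < σ a) := by
    intro a b hab
    refine ⟨?_, fun hlt => ⟨b, hab, hlt⟩⟩
    rintro ⟨j, hj, hlt⟩
    rwa [show b = j from Fin.ext (hab.trans hj.symm)]
  have hlast : ¬ ∃ j : Fin 5, (j : ℕ) = (4 : Fin 5) + 1 ∧ σ j < σ 4 := by
    rintro ⟨j, hj, -⟩
    exact absurd j.2 (by rw [hj]; decide)
  simp only [descentCode, des, wordCode, h0, h1, h2, h3, h4, Fin.val_fin_lt, unop_op]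
  rw [Finset.sum_filter, Fin.sum_univ_five]
  simp only [hs 0 1 rfl, hs 1 2 rfl, hs 2 3 rfl, hs 3 4 rfl, if_neg hlast]
  rfl

theorem wordCode_lt (f : ℕ → ℕ) : wordCode f < 16 := by
  unfold wordCode
  split_ifs <;> norm_num

theorem descentCode_lt (σ : Equiv.Perm (Fin 5)) : descentCode σ < 16 := by
  rw [descentCode_eq_wordCode σ (fun i => if h : i < 5 then σ ⟨i, h⟩ else 0) (by simp)]
  exact wordCode_lt _

/-- For each set of descents, the permutation with this set of descents that reverses intervals. -/
def reversals : List (List ℕ) :=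
  [[0, 1, 2, 3, 4], [1, 0, 2, 3, 4], [0, 2, 1, 3, 4], [2, 1, 0, 3, 4], [0, 1, 3, 2, 4], [1, 0, 3,
   2, 4], [0, 3, 2, 1, 4], [3, 2, 1, 0, 4], [0, 1, 2, 4, 3], [1, 0, 2, 4, 3], [0, 2, 1, 4, 3], [2,
   1, 0, 4, 3], [0, 1, 4, 3, 2], [1, 0, 4, 3, 2], [0, 4, 3, 2, 1], [4, 3, 2, 1, 0]]

/-- The permutation that reverses intervals and has a given descent set. -/
def reversal (k : Fin 16) : Equiv.Perm (Fin 5) :=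
  Function.Involutive.toPerm (fun i => Fin.ofNat 5 ((reversals.getD k []).getD i 0))
    (by revert k; unfold Function.Involutive; decide +kernel)

theorem reversal_apply : ∀ (k : Fin 16) (i : Fin 5),
    (reversals.getD k []).getD i 0 = (reversal k i : ℕ) := by
  decide +kernel

theorem descentCode_reversal : ∀ k : Fin 16, descentCode (reversal k) = k := by
  decide +kernel

theorem exists_des_reversal (σ : Equiv.Perm (Fin 5)) :
    ∃ k, des (op (reversal k)) = des (op σ) := by
  have h : ∀ S : Finset (Fin 5), 4 ∉ S → ∃ k, des (op (reversal k)) = S := by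
    decide +kernel
  refine h _ ?_
  simp only [des, Finset.mem_filter, Finset.mem_univ, true_and, not_exists, not_and]
  intro j hj
  have : ((4 : Fin 5) : ℕ) = 4 := rfl
  omega

/-- The list of the descent sets of `w * σ⁻¹`, where `w` is the reversal with the `k`th descent set
and where `σ` runs through the permutations with the `i`th descent set. -/
def quotientCodes (k i : ℕ) : List ℕ :=
  ((List.range 5).permutations'.filter fun l => wordCode (fun j => l.getD j 0) == i).map fun l =>
    wordCode fun j => (reversals.getD k []).getD (l.idxOf j) 0

theorem sum_descentCode (k : Fin 16) (i : ℕ) (d : ℕ → ℕ) :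
    ∑ σ with descentCode σ = i, d (descentCode (reversal k * σ⁻¹)) =
      ((quotientCodes k i).map d).sum := by
  have h1 : ∀ σ : Equiv.Perm (Fin 5), descentCode σ =
      wordCode fun j => (List.ofFn fun i => (σ i : ℕ)).getD j 0 := fun σ =>
    descentCode_eq_wordCode _ _ fun i => by
      rw [List.getD_eq_getElem _ _ (by simp), List.getElem_ofFn]
  have h2 : ∀ σ : Equiv.Perm (Fin 5), descentCode (reversal k * σ⁻¹) =
      wordCode fun j => (reversals.getD k []).getD
        ((List.ofFn fun i => (σ i : ℕ)).idxOf j) 0 := by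
    intro σ
    refine descentCode_eq_wordCode _ _ fun i => ?_
    have h : (List.ofFn fun i => (σ i : ℕ)).idxOf (i : ℕ) = (σ⁻¹ i : Fin 5) := by
      have hnd : (List.ofFn fun i => (σ i : ℕ)).Nodup :=
        List.nodup_ofFn.mpr (Fin.val_injective.comp σ.injective)
      have := hnd.idxOf_getElem (σ⁻¹ i : Fin 5) (by simp)
      rwa [List.getElem_ofFn, Fin.eta, show σ (σ⁻¹ i) = i from σ.apply_symm_apply i] at this
    rw [h, reversal_apply]
    rfl
  rw [Finset.sum_filter]
  simp only [h2]
  simp only [h1]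
  rw [sum_perm_eq_sum_permutations 5 fun l => if (wordCode fun j => l.getD j 0) = i then
    d (wordCode fun j => (reversals.getD k []).getD (l.idxOf j) 0) else 0]
  rw [quotientCodes, List.map_map]
  generalize (List.range 5).permutations' = L
  induction L with
  | nil => rfl
  | cons l L ih =>
    by_cases hl : (wordCode fun j => l.getD j 0) = i
    · simp only [List.map_cons, List.sum_cons, ih, hl, if_true, List.filter_cons, beq_self_eq_true,
        Function.comp]
    · simp only [List.map_cons, List.sum_cons, ih, hl, if_false, List.filter_cons, beq_iff_eq,
        zero_add]

/-- The values of `quotientCodes`. -/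
def quotientTable : List (List (List ℕ)) :=
  [[[0], [1, 2, 4, 8], [1, 2, 2, 5, 4, 4, 10, 9, 8], [3, 5, 6, 9, 10, 12], [1, 2, 2, 4, 5, 4, 9,
   10, 8], [3, 2, 5, 5, 6, 6, 5, 4, 11, 10, 9, 9, 10, 10, 13, 12], [3, 5, 6, 5, 6, 11, 10, 9, 10,
   13, 12], [7, 11, 13, 14], [1, 2, 4, 8], [3, 2, 5, 6, 5, 4, 9, 10, 9, 10, 12], [3, 2, 5, 6, 5, 4,
   5, 6, 9, 10, 11, 10, 9, 10, 13, 12], [7, 6, 5, 11, 11, 10, 13, 13, 14], [3, 5, 6, 9, 10, 12],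
   [7, 5, 6, 11, 10, 11, 13, 13, 14], [7, 11, 13, 14], [15]], [[1], [0, 2, 4, 8], [3, 2, 6, 5, 4,
   12, 10, 9, 8], [1, 5, 2, 9, 10, 4], [3, 2, 6, 5, 5, 4, 11, 10, 9], [1, 2, 4, 5, 6, 2, 5, 4, 9,
   10, 8, 9, 10, 10, 13, 12], [7, 5, 6, 13, 14, 11, 10, 9, 10, 13, 12], [3, 11, 5, 6], [3, 2, 5,
   9], [1, 2, 5, 6, 4, 4, 8, 10, 9, 10, 12], [7, 6, 5, 6, 5, 4, 13, 14, 11, 10, 11, 10, 9, 10, 13,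
   12], [3, 2, 5, 9, 11, 10, 13, 5, 6], [7, 5, 6, 11, 10, 13], [3, 5, 6, 9, 10, 11, 12, 13, 14],
   [15, 11, 13, 14], [7]], [[2], [1, 3, 5, 9], [1, 0, 2, 5, 4, 4, 10, 9, 8], [2, 4, 6, 8, 10, 12],
   [5, 6, 10, 4, 13, 12, 9, 10, 8], [3, 2, 5, 7, 6, 6, 5, 4, 11, 10, 9, 11, 10, 14, 13, 12], [3, 1,
   2, 5, 6, 11, 2, 9, 10, 5, 4], [5, 9, 13, 10], [5, 6, 4, 10], [3, 2, 7, 6, 5, 5, 9, 11, 11, 10,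
   13], [3, 2, 1, 2, 5, 4, 5, 6, 9, 8, 11, 10, 9, 10, 13, 12], [5, 6, 4, 10, 9, 10, 12, 13, 14],
   [11, 13, 14, 9, 10, 12], [7, 5, 6, 11, 10, 15, 13, 13, 14], [7, 3, 5, 6], [11]], [[3], [2, 1, 5,
   9], [2, 1, 6, 4, 5, 12, 10, 8, 9], [0, 4, 2, 8, 10, 4], [7, 6, 14, 5, 13, 12, 11, 10, 9], [5, 6,
   4, 3, 2, 10, 13, 12, 9, 10, 8, 11, 10, 6, 5, 4], [5, 3, 2, 13, 10, 9, 6, 11, 10, 5, 4], [1, 9,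
   5, 2], [7, 6, 5, 11], [5, 6, 3, 2, 4, 5, 10, 9, 11, 10, 13], [5, 6, 3, 2, 4, 5, 13, 14, 10, 9,
   9, 10, 11, 10, 12, 13], [1, 2, 4, 8, 9, 10, 12, 5, 6], [15, 13, 14, 11, 10, 13], [11, 13, 14, 9,
   10, 7, 12, 5, 6], [11, 7, 5, 6], [3]], [[4], [5, 2, 6, 10], [1, 2, 3, 5, 6, 5, 11, 9, 10], [3,
   5, 7, 9, 11, 13], [1, 2, 2, 0, 5, 4, 9, 10, 8], [3, 2, 1, 5, 4, 6, 5, 4, 11, 10, 9, 9, 8, 10,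
   13, 12], [2, 5, 4, 4, 6, 10, 10, 9, 8, 13, 12], [6, 10, 12, 14], [9, 10, 12, 8], [11, 10, 5, 6,
   13, 4, 9, 10, 13, 14, 12], [3, 2, 5, 6, 5, 4, 7, 6, 9, 10, 11, 10, 13, 14, 13, 12], [7, 6, 5,
   11, 11, 10, 13, 15, 14], [3, 5, 6, 1, 2, 4], [7, 5, 6, 3, 2, 11, 5, 9, 10], [5, 11, 9, 10],
   [13]], [[5], [4, 2, 6, 10], [3, 2, 7, 5, 6, 13, 11, 9, 10], [1, 5, 3, 9, 11, 5], [3, 2, 6, 1, 5,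
   4, 11, 10, 9], [1, 2, 0, 5, 4, 2, 5, 4, 9, 10, 8, 9, 8, 10, 13, 12], [6, 5, 4, 12, 14, 10, 10,
   9, 8, 13, 12], [2, 10, 4, 6], [11, 10, 13, 9], [9, 10, 5, 6, 12, 4, 8, 10, 13, 14, 12], [7, 6,
   5, 6, 5, 4, 15, 14, 11, 10, 11, 10, 13, 14, 13, 12], [3, 2, 5, 9, 11, 10, 13, 7, 6], [7, 5, 6,
   3, 2, 5], [3, 5, 6, 1, 2, 11, 4, 9, 10], [13, 11, 9, 10], [5]], [[6], [5, 3, 7, 11], [5, 4, 3,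
   1, 2, 5, 11, 9, 10], [2, 6, 5, 10, 9, 13], [5, 4, 10, 2, 13, 12, 9, 8, 10], [2, 3, 1, 6, 5, 6,
   4, 5, 10, 11, 9, 10, 9, 14, 12, 13], [2, 1, 0, 4, 6, 10, 2, 9, 8, 5, 4], [4, 8, 12, 10], [13,
   14, 12, 10], [11, 10, 7, 6, 13, 5, 9, 11, 15, 14, 13], [11, 10, 9, 10, 13, 12, 7, 6, 9, 8, 3, 2,
   5, 6, 5, 4], [5, 6, 4, 10, 13, 14, 12, 11, 10], [11, 9, 10, 5, 6, 4], [5, 7, 6, 3, 2, 13, 5, 11,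
   10], [5, 3, 1, 2], [9]], [[7], [6, 5, 3, 11], [6, 5, 5, 2, 3, 13, 9, 10, 11], [4, 2, 1, 10, 9,
   5], [6, 5, 14, 3, 12, 13, 10, 9, 11], [4, 5, 2, 2, 1, 10, 12, 13, 8, 9, 10, 10, 9, 6, 4, 5], [4,
   2, 1, 12, 10, 8, 6, 10, 9, 4, 5], [0, 8, 4, 2], [15, 14, 13, 11], [13, 14, 11, 10, 12, 13, 10,
   9, 7, 6, 5], [13, 14, 11, 10, 12, 13, 11, 10, 10, 9, 5, 6, 7, 6, 4, 5], [9, 10, 12, 8, 5, 6, 4,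
   3, 2], [13, 11, 10, 7, 6, 5], [9, 11, 10, 5, 6, 5, 4, 3, 2], [9, 5, 3, 2], [1]], [[8], [9, 10,
   4, 12], [9, 10, 2, 5, 4, 6, 10, 13, 12], [11, 5, 6, 13, 10, 14], [1, 2, 3, 4, 5, 6, 9, 10, 12],
   [3, 2, 5, 5, 6, 7, 5, 6, 11, 10, 13, 9, 10, 11, 13, 14], [3, 5, 6, 5, 7, 11, 11, 9, 10, 13, 14],
   [7, 11, 13, 15], [1, 2, 4, 0], [3, 2, 5, 6, 5, 4, 1, 2, 9, 10, 8], [3, 2, 5, 6, 5, 4, 5, 4, 1,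
   2, 11, 10, 9, 10, 9, 8], [7, 6, 5, 3, 11, 10, 9, 13, 12], [2, 5, 4, 9, 10, 8], [6, 5, 4, 11, 10,
   10, 9, 13, 12], [6, 10, 13, 12], [14]], [[9], [8, 10, 4, 12], [11, 10, 6, 5, 4, 14, 10, 13, 12],
   [9, 5, 2, 13, 10, 6], [3, 2, 7, 5, 5, 6, 11, 10, 13], [1, 2, 4, 5, 6, 3, 5, 6, 9, 10, 12, 9, 10,
   11, 13, 14], [7, 5, 6, 13, 15, 11, 11, 9, 10, 13, 14], [3, 11, 5, 7], [3, 2, 5, 1], [1, 2, 5, 6,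
   4, 4, 0, 2, 9, 10, 8], [7, 6, 5, 6, 5, 4, 13, 12, 3, 2, 11, 10, 9, 10, 9, 8], [3, 2, 5, 1, 11,
   10, 9, 5, 4], [6, 5, 4, 11, 10, 9], [2, 5, 4, 9, 10, 10, 8, 13, 12], [14, 10, 13, 12], [6]],
   [[10], [9, 11, 5, 13], [9, 8, 2, 5, 4, 6, 10, 13, 12], [10, 4, 6, 12, 10, 14], [5, 6, 11, 4, 13,
   14, 9, 10, 12], [3, 2, 5, 7, 6, 7, 5, 6, 11, 10, 13, 11, 10, 15, 13, 14], [3, 1, 2, 5, 7, 11, 3,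
   9, 10, 5, 6], [5, 9, 13, 11], [5, 6, 4, 2], [3, 2, 7, 6, 5, 5, 1, 3, 11, 10, 9], [3, 2, 1, 2, 5,
   4, 5, 4, 1, 0, 11, 10, 9, 10, 9, 8], [5, 6, 4, 2, 9, 10, 8, 13, 12], [10, 13, 12, 9, 10, 8], [6,
   5, 4, 11, 10, 14, 9, 13, 12], [6, 2, 5, 4], [10]], [[11], [10, 9, 5, 13], [10, 9, 6, 4, 5, 14,
   10, 12, 13], [8, 4, 2, 12, 10, 6], [7, 6, 15, 5, 13, 14, 11, 10, 13], [5, 6, 4, 3, 2, 11, 13,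
   14, 9, 10, 12, 11, 10, 7, 5, 6], [5, 3, 2, 13, 11, 9, 7, 11, 10, 5, 6], [1, 9, 5, 3], [7, 6, 5,
   3], [5, 6, 3, 2, 4, 5, 2, 1, 11, 10, 9], [5, 6, 3, 2, 4, 5, 13, 12, 2, 1, 9, 10, 11, 10, 8, 9],
   [1, 2, 4, 0, 9, 10, 8, 5, 4], [14, 13, 12, 11, 10, 9], [10, 13, 12, 9, 10, 6, 8, 5, 4], [10, 6,
   5, 4], [2]], [[12], [13, 10, 6, 14], [9, 10, 3, 5, 6, 7, 11, 13, 14], [11, 5, 7, 13, 11, 15],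
   [9, 10, 3, 8, 5, 6, 1, 2, 4], [11, 10, 9, 5, 4, 7, 5, 6, 3, 2, 5, 13, 12, 11, 9, 10], [2, 5, 4,
   6, 5, 10, 11, 13, 12, 9, 10], [6, 10, 14, 13], [9, 10, 8, 4], [11, 10, 5, 4, 9, 6, 5, 2, 13, 12,
   10], [2, 3, 5, 4, 5, 6, 6, 5, 1, 2, 10, 11, 13, 12, 9, 10], [6, 7, 5, 3, 10, 11, 9, 14, 13], [2,
   5, 4, 1, 2, 0], [6, 5, 4, 3, 2, 10, 1, 9, 8], [4, 10, 9, 8], [12]], [[13], [12, 10, 6, 14], [11,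
   10, 7, 5, 6, 15, 11, 13, 14], [9, 5, 3, 13, 11, 7], [11, 10, 7, 9, 5, 6, 3, 2, 5], [9, 10, 8, 5,
   4, 3, 5, 6, 1, 2, 4, 13, 12, 11, 9, 10], [6, 5, 4, 14, 13, 10, 11, 13, 12, 9, 10], [2, 10, 6,
   5], [11, 10, 9, 5], [9, 10, 5, 4, 8, 6, 4, 2, 13, 12, 10], [6, 7, 5, 4, 5, 6, 14, 13, 3, 2, 10,
   11, 13, 12, 9, 10], [2, 3, 5, 1, 10, 11, 9, 6, 5], [6, 5, 4, 3, 2, 1], [2, 5, 4, 1, 2, 10, 0, 9,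
   8], [12, 10, 9, 8], [4]], [[14], [13, 11, 7, 15], [13, 12, 11, 9, 10, 7, 3, 5, 6], [10, 6, 5,
   14, 13, 11], [13, 12, 11, 10, 9, 10, 5, 4, 6], [10, 11, 9, 6, 5, 5, 6, 7, 2, 3, 5, 14, 13, 13,
   10, 11], [10, 9, 8, 6, 5, 2, 3, 5, 4, 1, 2], [4, 12, 10, 9], [13, 12, 10, 6], [10, 11, 6, 5, 9,
   7, 5, 3, 14, 13, 11], [10, 11, 9, 8, 9, 10, 6, 5, 5, 4, 2, 3, 5, 4, 1, 2], [4, 5, 6, 2, 12, 13,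
   10, 10, 9], [10, 9, 8, 5, 4, 2], [4, 6, 5, 2, 3, 12, 1, 10, 9], [4, 2, 1, 0], [8]], [[15], [14,
   13, 11, 7], [14, 13, 13, 10, 11, 11, 5, 6, 7], [12, 10, 9, 6, 5, 3], [14, 13, 13, 11, 10, 11, 6,
   5, 7], [12, 13, 10, 10, 9, 9, 10, 11, 4, 5, 6, 6, 5, 5, 2, 3], [12, 10, 9, 10, 9, 4, 5, 6, 5, 2,
   3], [8, 4, 2, 1], [14, 13, 11, 7], [12, 13, 10, 9, 10, 11, 6, 5, 6, 5, 3], [12, 13, 10, 9, 10,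
   11, 10, 9, 6, 5, 4, 5, 6, 5, 2, 3], [8, 9, 10, 4, 4, 5, 2, 2, 1], [12, 10, 9, 6, 5, 3], [8, 10,
   9, 4, 5, 4, 2, 2, 1], [8, 4, 2, 1], [0]]]

theorem quotientTable_eq :
    quotientTable = (List.range 16).map fun k => (List.range 16).map (quotientCodes k) := by
  decide +kernel

theorem quotientTable_getD (k i : Fin 16) :
    (quotientTable.getD k []).getD i [] = quotientCodes k i := by
  rw [quotientTable_eq]
  simp [List.getD_eq_getElem?_getD]

/-- The element of the descent algebra whose coefficients are given by the descent sets. -/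
def descentElement (c : List ℕ) : MonoidAlgebra F (SymGroup 5) :=
  ∑ σ : Equiv.Perm (Fin 5),
    ((c.getD (descentCode σ) 0 : ℕ) : F) • MonoidAlgebra.of F (SymGroup 5) (op σ)

theorem descentElement_mem (c : List ℕ) : descentElement F c ∈ descentAlgebra F 5 :=
  mem_span_of_des F (fun v => ((c.getD (descentCode v.unop) 0 : ℕ) : F)) fun v w h => by
    have : descentCode v.unop = descentCode w.unop := by simp only [descentCode, op_unop, h]
    simp only [this]

theorem coeff_descentElement (c : List ℕ) (σ : Equiv.Perm (Fin 5)) :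
    (descentElement F c).coeff (op σ) = (c.getD (descentCode σ) 0 : ℕ) := by
  classical
  simp [descentElement, MonoidAlgebra.coeff_sum, Finsupp.finsetSum_apply, Finsupp.single_apply]

variable {F}

theorem eq_of_coeff_reversal {x y : MonoidAlgebra F (SymGroup 5)} (hx : x ∈ descentAlgebra F 5)
    (hy : y ∈ descentAlgebra F 5)
    (h : ∀ k, x.coeff (op (reversal k)) = y.coeff (op (reversal k))) : x = y := by
  ext w
  obtain ⟨k, hk⟩ := exists_des_reversal w.unop
  rw [op_unop] at hk
  rw [← coeff_eq_of_des_eq F hx hk, ← coeff_eq_of_des_eq F hy hk, h]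

/-- The value of a bilinear form that describes a coefficient of a product. -/
def pairing (t : List (List ℕ)) (c d : List ℕ) : ℕ :=
  ((List.range 16).map fun i => c.getD i 0 * ((t.getD i []).map fun j => d.getD j 0).sum).sum

/-- The coefficients of a product, modulo five, are as given. -/
def IsProduct (c d e : List ℕ) : Prop :=
  ∀ k : Fin 16, pairing (quotientTable.getD k []) c d % 5 = e.getD k 0 % 5

instance (c d e : List ℕ) : Decidable (IsProduct c d e) :=
  inferInstanceAs (Decidable (∀ _ : Fin 16, _ = _))

theorem sum_eq_pairing (c d : List ℕ) (k : Fin 16) :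
    ∑ σ, c.getD (descentCode σ) 0 * d.getD (descentCode (reversal k * σ⁻¹)) 0 =
      pairing (quotientTable.getD k []) c d := by
  have hp : pairing (quotientTable.getD k []) c d = ∑ i ∈ Finset.range 16,
      c.getD i 0 * (((quotientTable.getD k []).getD i []).map fun j => d.getD j 0).sum := rfl
  rw [hp, ← Finset.sum_fiberwise_of_maps_to (t := Finset.range 16) (g := descentCode)
    (fun σ _ => Finset.mem_range.mpr (descentCode_lt σ))]
  refine Finset.sum_congr rfl fun i hi => ?_
  rw [quotientTable_getD k ⟨i, Finset.mem_range.mp hi⟩,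
    ← sum_descentCode k i fun j => d.getD j 0, Finset.mul_sum]
  refine Finset.sum_congr rfl fun σ hσ => ?_
  rw [(Finset.mem_filter.mp hσ).2]

theorem descentElement_mul [CharP F 5] {c d e : List ℕ} (h : IsProduct c d e) :
    descentElement F c * descentElement F d = descentElement F e := by
  refine eq_of_coeff_reversal (mul_mem (descentElement_mem F c) (descentElement_mem F d))
    (descentElement_mem F e) fun k => ?_
  rw [coeff_mul_op]
  simp only [coeff_descentElement]
  rw [descentCode_reversal]
  have := (CharP.natCast_eq_natCast F 5).mpr (h k)
  rw [← this, ← sum_eq_pairing]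
  push_cast
  rfl

end Descent

namespace Descent

open PathAlgebra LoopQuiver Vertex MulOpposite

/-- The coefficients of the primitive idempotents. -/
def vertexCoeffs : Vertex → List ℕ
  | v1 => [3, 0, 2, 4, 4, 1, 3, 0, 0, 2, 4, 1, 1, 3, 0, 2]
  | v2 => [1, 2, 0, 0, 3, 4, 3, 3, 1, 2, 0, 0, 1, 2, 1, 1]
  | v3 => [4, 1, 0, 4, 0, 0, 0, 1, 4, 1, 0, 4, 0, 0, 0, 1]
  | v4 => [0, 0, 0, 0, 4, 4, 0, 0, 0, 0, 1, 0, 4, 4, 0, 0]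
  | v5 => [1, 4, 1, 4, 4, 1, 4, 1, 0, 0, 0, 0, 1, 4, 1, 4]
  | v6 => [2, 3, 2, 3, 0, 0, 0, 0, 0, 0, 0, 0, 3, 2, 3, 2]

/-- The coefficients of the elements that correspond to the arrows. -/
def arrowCoeffs : ∀ i j : Vertex, Arrow i j → List ℕ
  | _, _, .α => [0, 1, 3, 4, 3, 4, 1, 2, 3, 4, 1, 2, 1, 2, 4, 0]
  | _, _, .β => [0, 1, 4, 4, 0, 1, 0, 0, 0, 1, 4, 4, 0, 1, 0, 0]
  | _, _, .γ => [0, 1, 2, 4, 0, 0, 3, 1, 2, 3, 0, 2, 0, 0, 2, 0]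
  | _, _, .δ => [0, 0, 1, 3, 3, 2, 4, 0, 1, 4, 0, 1, 2, 3, 1, 0]
  | _, _, .η => [0, 0, 0, 0, 1, 4, 1, 4, 4, 1, 4, 1, 0, 0, 0, 0]
  | _, _, .ε => [4, 4, 4, 4, 4, 4, 4, 4, 4, 4, 4, 4, 4, 4, 4, 4]

/-- The coefficients of the elements that correspond to `LoopQuiver.paths`. -/
def pathCoeffs : Fin 16 → List ℕ :=
  ![vertexCoeffs v1, vertexCoeffs v2, vertexCoeffs v3, vertexCoeffs v4, vertexCoeffs v5,
    vertexCoeffs v6, arrowCoeffs _ _ .α, arrowCoeffs _ _ .β, arrowCoeffs _ _ .γ,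
    arrowCoeffs _ _ .δ, arrowCoeffs _ _ .η, arrowCoeffs _ _ .ε,
    [0, 1, 3, 4, 1, 2, 4, 0, 0, 1, 3, 4, 1, 2, 4, 0],
    [0, 3, 4, 4, 3, 1, 3, 3, 0, 3, 4, 4, 0, 3, 0, 0],
    [0, 3, 1, 4, 4, 2, 0, 3, 2, 0, 3, 1, 1, 4, 2, 0],
    [0, 4, 1, 0, 1, 3, 2, 4, 4, 2, 3, 1, 0, 1, 4, 0]]

/-- The inverse of the matrix of the coefficients of the paths, modulo five. -/
def inverseCoeffs : List (List ℕ) :=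
   [[1, 1, 1, 1, 1, 1, 0, 0, 0, 0, 0, 0, 0, 0, 0, 0],
    [2, 1, 0, 4, 4, 0, 0, 4, 3, 0, 1, 1, 0, 3, 3, 1],
    [3, 0, 4, 4, 0, 1, 1, 4, 0, 0, 3, 2, 1, 0, 3, 0],
    [0, 0, 0, 1, 0, 3, 4, 0, 2, 0, 1, 1, 4, 2, 0, 4],
    [3, 0, 4, 4, 0, 1, 2, 3, 0, 4, 1, 2, 0, 1, 0, 3],
    [0, 3, 0, 1, 0, 0, 0, 3, 2, 1, 0, 3, 0, 1, 4, 3],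
    [4, 4, 1, 1, 4, 4, 0, 3, 0, 1, 0, 2, 2, 4, 0, 2],
    [3, 1, 0, 4, 1, 0, 3, 3, 3, 4, 4, 1, 3, 4, 1, 2],
    [2, 1, 0, 4, 4, 0, 1, 3, 0, 0, 3, 1, 4, 2, 3, 0],
    [1, 4, 4, 1, 1, 4, 1, 0, 2, 0, 1, 2, 4, 2, 0, 4],
    [0, 3, 0, 1, 0, 0, 2, 3, 0, 0, 0, 3, 2, 3, 2, 0],
    [2, 0, 1, 4, 0, 1, 3, 1, 3, 0, 1, 2, 3, 3, 0, 1],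
    [0, 0, 0, 1, 0, 3, 1, 0, 0, 1, 1, 1, 1, 4, 0, 2],
    [2, 0, 1, 4, 0, 1, 4, 2, 3, 4, 3, 2, 1, 2, 3, 2],
    [3, 1, 0, 4, 1, 0, 4, 4, 0, 4, 2, 1, 1, 1, 2, 3],
    [4, 1, 4, 1, 4, 1, 4, 2, 2, 1, 4, 0, 4, 3, 4, 3]]

theorem isProduct_vertexCoeffs : ∀ i j : Vertex,
    IsProduct (vertexCoeffs i) (vertexCoeffs j) (if i = j then vertexCoeffs i else []) := by
  decide +kernel

theorem isProduct_vertexCoeffs_arrowCoeffs {i j : Vertex} (f : Arrow i j) :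
    IsProduct (vertexCoeffs j) (arrowCoeffs i j f) (arrowCoeffs i j f) := by
  cases f <;> decide +kernel

theorem isProduct_arrowCoeffs_vertexCoeffs {i j : Vertex} (f : Arrow i j) :
    IsProduct (arrowCoeffs i j f) (vertexCoeffs i) (arrowCoeffs i j f) := by
  cases f <;> decide +kernel

theorem isProduct_loop {i : Vertex} (f : Arrow i v4) :
    IsProduct (arrowCoeffs v4 v4 .ε) (arrowCoeffs i v4 f) [] := by
  cases f <;> decide +kernel

theorem isProduct_pathCoeffs :
    IsProduct (pathCoeffs 7) (pathCoeffs 6) (pathCoeffs 12) ∧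
    IsProduct (pathCoeffs 8) (pathCoeffs 7) (pathCoeffs 13) ∧
    IsProduct (pathCoeffs 8) (pathCoeffs 12) (pathCoeffs 14) ∧
    IsProduct (pathCoeffs 9) (pathCoeffs 10) (pathCoeffs 15) := by
  decide +kernel

theorem sum_pathCoeffs_mul_inverseCoeffs : ∀ i j : Fin 16,
    (∑ k : Fin 16, (pathCoeffs i).getD k 0 * (inverseCoeffs.getD k []).getD j 0) % 5 =
      (if i = j then 1 else 0) % 5 := by
  decide +kernel

theorem sum_vertexCoeffs : ∀ k : Fin 16,
    (∑ i, (vertexCoeffs i).getD k 0) % 5 = (if k = 0 then 1 else 0) % 5 := by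
  decide +kernel

variable (F : Type*) [Field F]

theorem descentElement_nil : descentElement F [] = 0 := by
  simp [descentElement]

theorem sum_vertexCoeffs_eq_one [CharP F 5] :
    ∑ i, descentElement F (vertexCoeffs i) = 1 := by
  refine eq_of_coeff_reversal (sum_mem fun i _ => descentElement_mem F _) (one_mem _) fun k => ?_
  classical
  have h1 : op (reversal k) = (1 : SymGroup 5) ↔ k = 0 := by
    rw [op_eq_one_iff]
    revert k
    decide +kernel
  have h := (CharP.natCast_eq_natCast F 5).mpr (sum_vertexCoeffs k)
  push_cast at h
  simp only [MonoidAlgebra.coeff_sum, Finsupp.finsetSum_apply, coeff_descentElement,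
    descentCode_reversal, h]
  rw [MonoidAlgebra.one_def, MonoidAlgebra.coeff_single, Finsupp.single_apply]
  exact if_congr (h1.symm.trans eq_comm) rfl rfl

/-- The idempotents of the descent algebra. -/
def vertexElement (i : Vertex) : descentAlgebra F 5 :=
  ⟨descentElement F (vertexCoeffs i), descentElement_mem F _⟩

/-- The arrows of the descent algebra. -/
def arrowElement (i j : Vertex) (f : i ⟶ j) : descentAlgebra F 5 :=
  ⟨descentElement F (arrowCoeffs i j f), descentElement_mem F _⟩

variable [CharP F 5]

/-- The homomorphism from the path algebra to the descent algebra. -/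
def descentHom : PathAlgebra F Vertex →ₐ[F] descentAlgebra F 5 :=
  lift (vertexElement F) (arrowElement F)
    (fun i => Subtype.ext <| by
      simpa [vertexElement] using descentElement_mul (F := F) (isProduct_vertexCoeffs i i))
    (fun i j hij => Subtype.ext <| by
      simpa [vertexElement, hij, descentElement_nil] using
        descentElement_mul (F := F) (isProduct_vertexCoeffs i j))
    (Subtype.ext <| by simpa [vertexElement] using sum_vertexCoeffs_eq_one F)
    (fun _ _ f => Subtype.ext <|
      descentElement_mul (isProduct_vertexCoeffs_arrowCoeffs f))

theorem coe_descentHom_vertex (i : Vertex) :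
    (descentHom F (vertex F i) : MonoidAlgebra F (SymGroup 5)) =
      descentElement F (vertexCoeffs i) :=
  congrArg Subtype.val (lift_vertex ..)

theorem coe_descentHom_arrow {i j : Vertex} (f : i ⟶ j) :
    (descentHom F (arrow F f) : MonoidAlgebra F (SymGroup 5)) =
      descentElement F (arrowCoeffs i j f) :=
  congrArg Subtype.val (lift_arrow _ _ _ _ _
    (Subtype.ext (descentElement_mul (isProduct_arrowCoeffs_vertexCoeffs f))))

theorem descentHom_relations (x : PathAlgebra F Vertex) (hx : x ∈ (relations F).asIdeal) :
    descentHom F x = 0 := by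
  have h : ∀ {i : Vertex} (f : i ⟶ v4),
      descentHom F (arrow F ε) * descentHom F (arrow F f) = 0 := fun f =>
    Subtype.ext <| by
      rw [MulMemClass.coe_mul, coe_descentHom_arrow, coe_descentHom_arrow]
      exact (descentElement_mul (isProduct_loop f)).trans (descentElement_nil F)
  exact map_relations (descentHom F) (h ε) (h γ) (h δ) hx

theorem coe_descentHom_paths (k : Fin 16) :
    (descentHom F (paths F k) : MonoidAlgebra F (SymGroup 5)) =
      descentElement F (pathCoeffs k) := by
  have hm : ∀ {x y : PathAlgebra F Vertex} {c d e : List ℕ},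
      (descentHom F x : MonoidAlgebra F (SymGroup 5)) = descentElement F c →
      (descentHom F y : MonoidAlgebra F (SymGroup 5)) = descentElement F d →
      IsProduct c d e →
      (descentHom F (x * y) : MonoidAlgebra F (SymGroup 5)) = descentElement F e := by
    intro x y c d e hx hy h
    rw [map_mul, MulMemClass.coe_mul, hx, hy, descentElement_mul h]
  have hv := coe_descentHom_vertex F
  have hα := coe_descentHom_arrow F α
  have hβ := coe_descentHom_arrow F β
  have hγ := coe_descentHom_arrow F γ
  have hδ := coe_descentHom_arrow F δ
  have hη := coe_descentHom_arrow F η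
  have hε := coe_descentHom_arrow F ε
  obtain ⟨h12, h13, h14, h15⟩ := isProduct_pathCoeffs
  have hβα := hm hβ hα h12
  fin_cases k
  exacts [hv v1, hv v2, hv v3, hv v4, hv v5, hv v6, hα, hβ, hγ, hδ, hη, hε, hβα, hm hγ hβ h13,
    hm hγ hβα h14, hm hδ hη h15]

theorem linearIndependent_descentHom_paths :
    LinearIndependent F (descentHom F ∘ paths F) := by
  rw [Fintype.linearIndependent_iff]
  intro g hg j
  have h0 : ∀ k : Fin 16, ∑ i, g i * ((pathCoeffs i).getD k 0 : ℕ) = 0 := by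
    intro k
    have h := congrArg (fun x : descentAlgebra F 5 => x.1.coeff (op (reversal k))) hg
    simpa only [AddSubmonoidClass.coe_finsetSum, SetLike.val_smul, Function.comp_apply,
      coe_descentHom_paths, MonoidAlgebra.coeff_sum, Finsupp.finsetSum_apply,
      MonoidAlgebra.coeff_smul, Finsupp.smul_apply, coeff_descentElement, descentCode_reversal,
      smul_eq_mul, ZeroMemClass.coe_zero, MonoidAlgebra.coeff_zero, Finsupp.zero_apply] using h
  have h1 : ∀ i, ∑ k : Fin 16, (((pathCoeffs i).getD k 0 : ℕ) : F) *
      ((inverseCoeffs.getD k []).getD j 0 : ℕ) = if i = j then 1 else 0 := by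
    intro i
    have h := (CharP.natCast_eq_natCast F 5).mpr (sum_pathCoeffs_mul_inverseCoeffs i j)
    push_cast at h
    exact h
  calc g j = ∑ i, g i * (if i = j then 1 else 0) := by simp
    _ = ∑ k : Fin 16, (∑ i, g i * ((pathCoeffs i).getD k 0 : ℕ)) *
          ((inverseCoeffs.getD k []).getD j 0 : ℕ) := by
      simp only [← h1, Finset.mul_sum, Finset.sum_mul, mul_assoc]
      exact Finset.sum_comm
    _ = 0 := by simp only [h0, zero_mul, Finset.sum_const_zero]

omit [CharP F 5] in
theorem finrank_descentAlgebra_le (n : ℕ) :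
    Module.finrank F (descentAlgebra F n) ≤ 2 ^ (n - 1) := by
  rw [← composition_card n]
  exact finrank_range_le_card (R := F) (Xi F (n := n))

/-- In characteristic five, the descent algebra of degree five is the path algebra of the quiver
with a loop, modulo the relations. -/
def descentAlgebraEquiv :
    (PathAlgebra F Vertex ⧸ (relations F).asIdeal) ≃ₐ[F] descentAlgebra F 5 :=
  AlgEquiv.ofBijective _ (by
    have hinj := injective_liftₐ (descentHom F) (descentHom_relations F)
      (linearIndependent_descentHom_paths F)
    refine ⟨hinj, ?_⟩
    have hfin : Module.Finite F (descentAlgebra F 5) :=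
      Module.Finite.span_of_finite F (Set.finite_range (Xi F (n := 5)))
    have hspan := (linearIndependent_descentHom_paths F).span_eq_top_of_card_eq_finrank'
      (le_antisymm (linearIndependent_descentHom_paths F).fintype_card_le_finrank
        (by simpa using finrank_descentAlgebra_le F 5))
    intro y
    have hy : y ∈ Submodule.span F (Set.range (descentHom F ∘ paths F)) := hspan ▸ trivial
    obtain ⟨c, rfl⟩ := (Submodule.mem_span_range_iff_exists_fun F).mp hy
    refine ⟨Ideal.Quotient.mkₐ F _ (∑ i, c i • paths F i), ?_⟩
    change descentHom F (∑ i, c i • paths F i) = _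
    simp)

end Descent

theorem lemma5p9 {F : Type*} [Field F] :
    (Module.finrank F (PathAlgebra F E7Quiver.Vertex ⧸
        Subalgebra.toSubmodule (E7Quiver.mergedSubalgebra F)) = 1 ∧
      (E7Quiver.mergedSubalgebra F).val ''
          (Ring.jacobson (E7Quiver.mergedSubalgebra F) : Set (E7Quiver.mergedSubalgebra F)) =
        (Ring.jacobson (PathAlgebra F E7Quiver.Vertex) :
          Set (PathAlgebra F E7Quiver.Vertex))) ∧
    (CharP F 5 →
      Nonempty (Descent.descentAlgebra F 5 ≃ₐ[F]
        (PathAlgebra F LoopQuiver.Vertex ⧸ (LoopQuiver.relations F).asIdeal)) ∧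
      Nonempty (Descent.descentAlgebra F 5 ≃ₐ[F] E7Quiver.mergedSubalgebra F)) := by
  refine ⟨⟨E7Quiver.finrank_quotient_mergedSubalgebra F,
    E7Quiver.image_jacobson_mergedSubalgebra F⟩, fun _ => ?_⟩
  have e := (Descent.descentAlgebraEquiv F).symm
  exact ⟨⟨e⟩, ⟨e.trans (E7Quiver.mergedSubalgebraEquiv F)⟩⟩

end
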